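/- For $\alpha,\beta\ge 0$ define $F^{(\alpha,\beta)}_{dK}:(0,\infty)^2\to(0,\infty)^2$ by $$F^{(\alpha,\beta)}_{dK}(x,u)=\left(\frac{u(1+\beta xu)}{1+\alpha xu},\ \frac{x(1+\alpha xu)}{1+\beta xu}\right).$$ Writing $F=F^{(\alpha,\beta)}_{dK}$, let $\mathcal X^{*}$ be the set of $x=(x_n)_{n\in\mathbb Z}\in(0,\infty)^{\mathbb Z}$ for which there is exactly one family $(x_n^t,u_n^t)_{n,t\in\mathbb Z}$ in $(0,\infty)^2$ with $F(x_n^t,u_{n-1}^t)=(x_n^{t+1},u_n^t)$ for all $n,t\in\mathbb Z$ and $x_n^0=x_n$ for all $n\in\mathbb{Z}$, and let $\mathcal X^{\exists!}$ be the set of $x\in(0,\infty)^{\mathbb Z}$ for which there is exactly one sequence $(u_n)_{n\in\mathbb Z}$ in $(0,\infty)$ with $F^{(2)}(x_n,u_{n-1})=u_n$ for all $n\in\mathbb{Z}$ (superscripts $(1)$, $(2)$ denote coordinates of $F$). The one time-step dynamics $\mathcal T^{(\alpha,\beta)}_{dK}$ is the map defined on $\mathcal X^{*}\cup\mathcal X^{\exists!}$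 by $\mathcal T^{(\alpha,\beta)}_{dK}(x)_n=F^{(1)}(x_n,U_{n-1}(x))$, where $U_n(x)=u_n^0$ if $x\in\mathcal X^{*}$ and $U_n(x)=u_n$ if $x\in\mathcal X^{\exists!}$ (the two agree on $\mathcal X^{*}\cap\mathcal X^{\exists!}$). For $\lambda,c,c_1,c_2>0$, let $\mathrm{IG}(\lambda,c)$ be the probability measure on $(0,\infty)$ with density proportional to $x^{-\lambda-1}e^{-cx^{-1}}$, and $\mathrm{GIG}(\lambda,c_1,c_2)$ the probability measure on $(0,\infty)$ with density proportional to $x^{-\lambda-1}e^{-c_1x-c_2x^{-1}}$. A probability measure $P$ on $(0,\infty)^{\mathbb Z}$ is called ergodic under $\mathcal T$ if $\mathcal T$ is defined $P$-almost everywhere and coincides $P$-almost everywhere with a measurable map that preserves $P$ and for which every measurable invariant set has $P$-measure $0$ or $1$. **Theorem.** Let $\alpha>0$, $\lambda>0$, $c>0$, and set $\mu=\mathrm{GIG}(\lambda,c\alpha,c)$, $\nu=\mathrm{IG}(\lambda,c)$. If $2\int\log(x)\,\nu(dx)<-\log\alpha$, then the product measure $\mu^{\mathbb Z}$ is ergodic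 under $\mathcal T^{(\alpha,0)}_{dK}$, and the product measure $\nu^{\mathbb Z}$ is ergodic under $\mathcal T^{(0,\alpha)}_{dK}$. -/

import Mathlib

open MeasureTheory
open scoped NNReal

noncomputable section

namespace DiscreteKdV

/-! ### Homogeneous lattice models driven by a map `F : X × U → X × U` -/

section Lattice

variable {X U : Type*}

/-- `(ξ, u)`, with `ξ t n` and `u t n` standing for `x_n^t` and `u_n^t`, solves the initial value
problem `F (x_n^t, u_{n-1}^t) = (x_n^{t+1}, u_n^t)` for all `n, t ∈ ℤ`, with `x_n^0 = x_n`. -/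
def IsSolution (F : X × U → X × U) (x : ℤ → X) (p : (ℤ → ℤ → X) × (ℤ → ℤ → U)) : Prop :=
  (∀ n t : ℤ, F (p.1 t n, p.2 t (n - 1)) = (p.1 (t + 1) n, p.2 t n)) ∧ ∀ n : ℤ, p.1 0 n = x n

/-- The set `𝒳*` of configurations for which the initial value problem has exactly one solution. -/
def uniqueSolutionSet (F : X × U → X × U) : Set (ℤ → X) :=
  {x | ∃! p : (ℤ → ℤ → X) × (ℤ → ℤ → U), IsSolution F x p}

/-- `u` is a carrier for `x`: `F⁽²⁾ (x_n, u_{n-1}) = u_n` for all `n ∈ ℤ`. -/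
def IsCarrier (F : X × U → X × U) (x : ℤ → X) (u : ℤ → U) : Prop :=
  ∀ n : ℤ, (F (x n, u (n - 1))).2 = u n

/-- The set `𝒳^∃!` of configurations that have exactly one carrier. -/
def uniqueCarrierSet (F : X × U → X × U) : Set (ℤ → X) :=
  {x | ∃! u : ℤ → U, IsCarrier F x u}

open Classical in
/-- The carrier `U(x)`: on `𝒳*` it is the time-zero carrier of the unique solution of the initial
value problem, and on the rest of `𝒳^∃!` it is the unique carrier. The two descriptions agree on
`𝒳* ∩ 𝒳^∃!`, see `mem_dynamics_of_isCarrier`. -/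
def carrier (F : X × U → X × U) (x : ℤ → X)
    (h : x ∈ uniqueSolutionSet F ∪ uniqueCarrierSet F) : ℤ → U :=
  if hx : x ∈ uniqueSolutionSet F then (Exists.choose hx.exists).2 0
  else Exists.choose (h.resolve_left hx).exists

/-- The one time-step dynamics `𝒯`, a partial map with domain `𝒳* ∪ 𝒳^∃!`, given by
`𝒯(x)_n = F⁽¹⁾ (x_n, U_{n-1}(x))`. -/
def dynamics (F : X × U → X × U) : (ℤ → X) →. (ℤ → X) := fun x =>
  ⟨x ∈ uniqueSolutionSet F ∪ uniqueCarrierSet F, fun h n => (F (x n, carrier F x h (n - 1))).1⟩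

/-- On `𝒳*`, the dynamics is `x ↦ (x_n^1)_n`. -/
theorem mem_dynamics_of_isSolution {F : X × U → X × U} {x : ℤ → X}
    (hx : x ∈ uniqueSolutionSet F) {p : (ℤ → ℤ → X) × (ℤ → ℤ → U)} (hp : IsSolution F x p) :
    p.1 1 ∈ dynamics F x := by
  refine ⟨Or.inl hx, ?_⟩
  have hc : carrier F x (Or.inl hx) = p.2 0 := by
    unfold carrier
    rw [dif_pos hx, hx.unique hx.exists.choose_spec hp]
  funext n
  change (F (x n, carrier F x (Or.inl hx) (n - 1))).1 = p.1 1 n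
  rw [hc, ← hp.2 n, hp.1 n 0]
  simp

/-- On `𝒳^∃!`, the dynamics is given by the unique carrier. -/
theorem mem_dynamics_of_isCarrier {F : X × U → X × U} {x : ℤ → X}
    (hx : x ∈ uniqueCarrierSet F) {u : ℤ → U} (hu : IsCarrier F x u) :
    (fun n => (F (x n, u (n - 1))).1) ∈ dynamics F x := by
  refine ⟨Or.inr hx, ?_⟩
  have hc : carrier F x (Or.inr hx) = u := by
    unfold carrier
    by_cases h : x ∈ uniqueSolutionSet F
    · rw [dif_pos h]
      refine hx.unique (fun n => ?_) hu
      have hs := h.exists.choose_spec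
      rw [← hs.2 n, hs.1 n 0]
    · rw [dif_neg h]
      exact hx.unique (Exists.choose_spec _) hu
  funext n
  change (F (x n, carrier F x (Or.inr hx) (n - 1))).1 = _
  rw [hc]

end Lattice

/-! ### Ergodicity -/

/-- The probability measure `P` is (invariant and) ergodic under the partial map `T`: up to a
`P`-null set, `T` is defined and coincides with a measurable map that preserves `P` and is ergodic.
(The domain of `T` need not be a Borel set. The choice of the measurable version `S` is
irrelevant, since invariance and ergodicity of a measurable map depend only on its a.e. class.) -/
def IsErgodicUnder {Ω : Type*} [MeasurableSpace Ω] (T : Ω →. Ω) (P : Measure Ω) : Prop :=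
  IsProbabilityMeasure P ∧ ∃ S : Ω → Ω, Ergodic S P ∧ ∀ᵐ x ∂P, S x ∈ T x

/-! ### The (modified) discrete KdV map -/

/-- The state space `(0, ∞)`. -/
abbrev PosReal : Type := Set.Ioi (0 : ℝ)

/-- `F_dK^{(α,β)}(x,u) = (u(1 + βxu)/(1 + αxu), x(1 + αxu)/(1 + βxu))` on `(0,∞)²`. -/
def dKdV (α β : ℝ≥0) (p : PosReal × PosReal) : PosReal × PosReal :=
  have hx : (0 : ℝ) < p.1 := p.1.2
  have hu : (0 : ℝ) < p.2 := p.2.2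
  (⟨(p.2 : ℝ) * (1 + β * p.1 * p.2) / (1 + α * p.1 * p.2), Set.mem_Ioi.2 (by positivity)⟩,
   ⟨(p.1 : ℝ) * (1 + α * p.1 * p.2) / (1 + β * p.1 * p.2), Set.mem_Ioi.2 (by positivity)⟩)

/-! ### The distributions -/

/-- The probability measure on `(0, ∞)` whose density with respect to Lebesgue measure is
proportional to `f`. -/
def normalizedDensity (f : ℝ → ℝ) : Measure PosReal :=
  let m : Measure PosReal :=
    (Measure.comap Subtype.val (volume : Measure ℝ)).withDensity fun x => ENNReal.ofReal (f x)
  (m Set.univ)⁻¹ • m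

/-- The inverse gamma distribution `IG(lam, c)`: density `Z⁻¹ x^(-lam-1) exp(-c/x)` on `(0,∞)`. -/
def invGamma (lam c : ℝ) : Measure PosReal :=
  normalizedDensity fun x => x ^ (-lam - 1) * Real.exp (-c * x⁻¹)

/-- The generalized inverse Gaussian distribution `GIG(lam, c₁, c₂)`: density
`Z⁻¹ x^(-lam-1) exp(-c₁ x - c₂/x)` on `(0,∞)`. -/
def genInvGaussian (lam c₁ c₂ : ℝ) : Measure PosReal :=
  normalizedDensity fun x => x ^ (-lam - 1) * Real.exp (-c₁ * x - c₂ * x⁻¹)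

end DiscreteKdV

end

noncomputable section

namespace DiscreteKdV

open Filter Topology ProbabilityTheory

/-! ### The map `dKdV` -/

/-! Exchanging space and time turns the lattice of `dKdV α 0` into that of `dKdV 0 α`, so one random
field carries both dynamics, and each is a factor of a Bernoulli shift.

For `dKdV 0 α` the carrier recursion `c ↦ y / (1 + α y c)` never increases relative errors, and
contracts them at sites where `α y_k y_{k-1}` is bounded. Poincaré recurrence supplies such sites
towards `-∞` for almost every i.i.d. `y`, so the carrier is unique and forgets its starting value
(`near_carriers`, `ae_recurrent`). Since the local map preserves `ν ⊗ μ`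
(`measurePreserving_dKdV_swap`), Burke's property follows: `evolve` preserves `ν^ℤ`, and the
carriers at one fixed site along the orbit are i.i.d. with law `μ` (`measurePreserving_updateTo`,
`measurePreserving_carrierRow`).

A column `y` with law `ν^ℤ` thus generates a solution of the initial value problem of `dKdV α 0`
whose row `Φ y = initialRow α y` has law `μ^ℤ`. A solution of this problem is unique whenever it
exists (`IsSolution.eq`), so `Φ` is almost surely injective and `Φ y` lies in the domain of the
dynamics. Time translation of the field is the shift of the column and the dynamics of the row;
space translation is `evolve` on the column and the shift of the row. Hence `Φ` and its measurable
inverse exhibit both systems as factors of Bernoulli shifts (`isErgodicUnder_dynamics`). -/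

theorem dKdV_involutive (α β : ℝ≥0) : Function.Involutive (dKdV α β) := by
  rintro ⟨⟨x, hx⟩, ⟨u, hu⟩⟩
  have hx' : (0 : ℝ) < x := hx
  have hu' : (0 : ℝ) < u := hu
  have h1 : (0 : ℝ) < 1 + α * x * u := by positivity
  have h2 : (0 : ℝ) < 1 + β * x * u := by positivity
  have key : ∀ γ : ℝ, 1 + γ * (u * (1 + β * x * u) / (1 + α * x * u)) *
      (x * (1 + α * x * u) / (1 + β * x * u)) = 1 + γ * x * u := by
    intro γ; field_simp
  refine Prod.ext (Subtype.ext ?_) (Subtype.ext ?_)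
  · simp only [dKdV]
    rw [key, key]; field_simp
  · simp only [dKdV]
    rw [key, key]; field_simp

theorem dKdV_swap (α β : ℝ≥0) (p : PosReal × PosReal) :
    dKdV β α p.swap = (dKdV α β p).swap := by
  obtain ⟨⟨x, hx⟩, ⟨u, hu⟩⟩ := p
  refine Prod.ext (Subtype.ext ?_) (Subtype.ext ?_) <;>
  · simp only [dKdV, Prod.swap]
    rw [mul_right_comm (α : ℝ), mul_right_comm (β : ℝ)]

theorem coe_dKdV_left_fst (α : ℝ≥0) (x u : PosReal) :
    ((dKdV α 0 (x, u)).1 : ℝ) = u / (1 + α * x * u) := by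
  simp [dKdV]

theorem coe_dKdV_left_snd (α : ℝ≥0) (x u : PosReal) :
    ((dKdV α 0 (x, u)).2 : ℝ) = x * (1 + α * x * u) := by
  simp [dKdV]

theorem coe_dKdV_right_snd (α : ℝ≥0) (x u : PosReal) :
    ((dKdV 0 α (x, u)).2 : ℝ) = x / (1 + α * x * u) := by
  simp [dKdV]

theorem continuous_dKdV (α β : ℝ≥0) : Continuous (dKdV α β) := by
  have h : ∀ γ : ℝ≥0, ∀ p : PosReal × PosReal, 1 + (γ : ℝ) * p.1 * p.2 ≠ 0 := by
    intro γ p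
    have h1 : (0 : ℝ) < p.1 := p.1.2
    have h2 : (0 : ℝ) < p.2 := p.2.2
    positivity
  unfold dKdV
  refine Continuous.prodMk (Continuous.subtype_mk ?_ _) (Continuous.subtype_mk ?_ _)
  · exact Continuous.div (by fun_prop) (by fun_prop) (h α)
  · exact Continuous.div (by fun_prop) (by fun_prop) (h β)

/-! ### Uniqueness for the initial value problem of `dKdV α 0` -/

/-- If the affine recursion `v_k = x_k + a x_k² v_{k+1}` and the one driven by the updated
configuration `v_{k+1} x_k / v_k` both have positive solutions, then the homogeneous part of `v`
vanishes at infinity. -/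
theorem tendsto_prod_mul_carrier {a : ℝ} (ha : 0 < a) {x v w : ℕ → ℝ} (hx : ∀ k, 0 < x k)
    (hv : ∀ k, 0 < v k) (hw : ∀ k, 0 < w k) (hxv : ∀ k, v k = x k + a * x k ^ 2 * v (k + 1))
    (hxw : ∀ k, w k = v (k + 1) * x k / v k +
      a * (v (k + 1) * x k / v k) ^ 2 * w (k + 1)) :
    Tendsto (fun k => (∏ j ∈ Finset.range k, a * x j ^ 2) * v k) atTop (𝓝 0) := by
  set p : ℕ → ℝ := fun k => ∏ j ∈ Finset.range k, a * x j ^ 2 with hp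
  have hp0 : ∀ k, 0 < p k := fun k =>
    Finset.prod_pos fun j _ => mul_pos ha (pow_pos (hx j) 2)
  have hps : ∀ k, p (k + 1) = p k * (a * x k ^ 2) := fun k => Finset.prod_range_succ _ _
  have hdiff : ∀ k, p k * v k - p (k + 1) * v (k + 1) = p k * x k := by
    intro k; rw [hps, hxv k]; ring
  have hanti : Antitone fun k => p k * v k := by
    refine antitone_nat_of_succ_le fun k => ?_
    have := mul_pos (hp0 k) (hx k)
    linarith [hdiff k]
  have hbdd : BddBelow (Set.range fun k => p k * v k) :=
    ⟨0, by rintro _ ⟨k, rfl⟩; exact (mul_pos (hp0 k) (hv k)).le⟩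
  have hlim := tendsto_atTop_ciInf hanti hbdd
  set d := ⨅ k, p k * v k
  -- The multipliers `a (v_{j+1} x_j / v_j)²` of the updated recursion telescope to `p_k v_k² /
  -- v_0²`.
  have hw0 : ∀ k, p k * v k ^ 2 / v 0 ^ 2 * w k ≤ w 0 := by
    intro k
    induction k with
    | zero => simp [hp, (hv 0).ne']
    | succ k ih =>
      refine le_trans ?_ ih
      have hvk := hv k
      have hv0 := hv 0
      have h1 : a * (v (k + 1) * x k / v k) ^ 2 * w (k + 1) ≤ w k := by
        rw [hxw k]
        have : 0 < v (k + 1) * x k / v k := div_pos (mul_pos (hv _) (hx k)) hvk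
        linarith
      calc p (k + 1) * v (k + 1) ^ 2 / v 0 ^ 2 * w (k + 1)
          = p k * v k ^ 2 / v 0 ^ 2 * (a * (v (k + 1) * x k / v k) ^ 2 * w (k + 1)) := by
            rw [hps]; field_simp
        _ ≤ _ := mul_le_mul_of_nonneg_left h1 (by have := hp0 k; positivity)
  -- The existence of `w` bounds a product of consecutive terms of the decreasing sequence `p_k v_k`
  -- by its decrement; in the limit `d² ≤ 0`.
  have hkey : ∀ k, (p k * v k) * (p (k + 1) * v (k + 1)) ≤
      a * v 0 ^ 2 * w 0 * (p k * v k - p (k + 1) * v (k + 1)) := by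
    intro k
    have hvk := hv k
    have hv0 := hv 0
    have hvk1 := hv (k + 1)
    have hxk := hx k
    have hpk := hp0 k
    have h1 : v (k + 1) * x k / v k ≤ w k := by
      rw [hxw k]
      have := hw (k + 1)
      have : 0 ≤ a * (v (k + 1) * x k / v k) ^ 2 * w (k + 1) := by positivity
      linarith
    have h2 : p k * v k * v (k + 1) * x k / v 0 ^ 2 ≤ w 0 := by
      refine le_trans ?_ (hw0 k)
      calc p k * v k * v (k + 1) * x k / v 0 ^ 2
          = p k * v k ^ 2 / v 0 ^ 2 * (v (k + 1) * x k / v k) := by field_simp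
        _ ≤ _ := mul_le_mul_of_nonneg_left h1 (by positivity)
    rw [div_le_iff₀ (by positivity)] at h2
    rw [hdiff, hps]
    calc _ = a * x k * p k * (p k * v k * v (k + 1) * x k) := by ring
      _ ≤ a * x k * p k * (w 0 * v 0 ^ 2) := mul_le_mul_of_nonneg_left h2 (by positivity)
      _ = _ := by ring
  have hlim1 := hlim.comp (tendsto_add_atTop_nat 1)
  have hle : d * d ≤ a * v 0 ^ 2 * w 0 * (d - d) :=
    le_of_tendsto_of_tendsto' (hlim.mul hlim1) ((hlim.sub hlim1).const_mul _) hkey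
  have hd : d = 0 := by nlinarith [mul_self_nonneg d]
  rwa [hd] at hlim

/-- At most one carrier of `x` leads to a configuration that has a carrier itself. -/
theorem carrier_unique_of_isCarrier_next {α : ℝ≥0} (hα : 0 < α) {x : ℤ → PosReal}
    {v v' w w' : ℤ → PosReal} (hv : IsCarrier (dKdV α 0) x v) (hv' : IsCarrier (dKdV α 0) x v')
    (hw : IsCarrier (dKdV α 0) (fun n => (dKdV α 0 (x n, v (n - 1))).1) w)
    (hw' : IsCarrier (dKdV α 0) (fun n => (dKdV α 0 (x n, v' (n - 1))).1) w') : v = v' := by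
  have ha : (0 : ℝ) < α := hα
  have hrec : ∀ {v : ℤ → PosReal}, IsCarrier (dKdV α 0) x v → ∀ n, (v n : ℝ) =
      x n + α * (x n : ℝ) ^ 2 * v (n - 1) := by
    intro v hv n
    rw [← hv n, coe_dKdV_left_snd]; ring
  have hlim : ∀ {v w : ℤ → PosReal}, IsCarrier (dKdV α 0) x v →
      IsCarrier (dKdV α 0) (fun n => (dKdV α 0 (x n, v (n - 1))).1) w → ∀ n : ℤ,
      Tendsto (fun k : ℕ => (∏ j ∈ Finset.range k, (α : ℝ) * (x (n - j) : ℝ) ^ 2) * v (n - k))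
        atTop (𝓝 0) := by
    intro v w hv hw n
    have hidx : ∀ k : ℕ, n - ((k + 1 : ℕ) : ℤ) = n - k - 1 := fun k => by push_cast; ring
    refine tendsto_prod_mul_carrier (w := fun k => (w (n - k) : ℝ)) ha (fun k => (x _).2)
      (fun k => (v _).2) (fun k => (w _).2) (fun k => ?_) (fun k => ?_)
    · rw [hidx]; exact hrec hv _
    · have hx' : ((dKdV α 0 (x (n - k), v (n - k - 1))).1 : ℝ) =
          v (n - k - 1) * x (n - k) / v (n - k) := by
        have h1 : (0 : ℝ) < x (n - k) := (x _).2
        have h2 : (0 : ℝ) < v (n - k - 1) := (v _).2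
        rw [coe_dKdV_left_fst, hrec hv (n - k)]
        field_simp
      have := hw (n - k)
      rw [hidx, ← this, coe_dKdV_left_snd, hx']
      ring
  funext n
  refine Subtype.ext (sub_eq_zero.1 ?_)
  -- The recursion is affine, so the difference of two carriers solves the homogeneous one.
  have hD : ∀ k : ℕ, (v n : ℝ) - v' n =
      (∏ j ∈ Finset.range k, (α : ℝ) * (x (n - j) : ℝ) ^ 2) * v (n - k) -
      (∏ j ∈ Finset.range k, (α : ℝ) * (x (n - j) : ℝ) ^ 2) * v' (n - k) := by
    intro k
    induction k with
    | zero => simp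
    | succ k ih =>
      have hidx : n - ((k + 1 : ℕ) : ℤ) = n - k - 1 := by push_cast; ring
      rw [ih, hrec hv (n - k), hrec hv' (n - k), Finset.prod_range_succ, hidx]; ring
  have := (hlim hv hw n).sub (hlim hv' hw' n)
  simp only [← hD, sub_zero] at this
  exact tendsto_nhds_unique tendsto_const_nhds this

/-! ### Uniqueness of two-sided solutions -/

theorem IsSolution.isCarrier {X U : Type*} {F : X × U → X × U} {x : ℤ → X}
    {p : (ℤ → ℤ → X) × (ℤ → ℤ → U)} (hp : IsSolution F x p) (t : ℤ) :
    IsCarrier F (p.1 t) (p.2 t) := fun n => by rw [hp.1 n t]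

/-- Rotation of a solution of the initial value problem of an involution by `180` degrees. -/
theorem IsSolution.rotate {X U : Type*} {F : X × U → X × U} (hF : Function.Involutive F)
    {x : ℤ → X} {p : (ℤ → ℤ → X) × (ℤ → ℤ → U)} (hp : IsSolution F x p) :
    IsSolution F (fun n => x (-n))
      (fun t n => p.1 (-t) (-n), fun t n => p.2 (-t - 1) (-n - 1)) := by
  refine ⟨fun n t => ?_, fun n => by simpa using hp.2 (-n)⟩
  -- The cell `(n, t)` touches times `t` and `t + 1`, so its rotation is the cell `(-n, -t - 1)`;
  -- the involution exchanges inputs and outputs.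
  have h := hp.1 (-n) (-t - 1)
  have h2 := congrArg F h
  rw [hF, show -t - 1 + 1 = -t by ring] at h2
  dsimp only
  rw [show -(n - 1) - 1 = -n by ring, ← h2, show -(t + 1) = -t - 1 by ring]

/-- Equal rows at time `t` have equal carriers, because each solution continues to time `t + 1` and
so its next row has a carrier too. The local map then gives equal rows at time `t + 1`. -/
theorem IsSolution.eq_forward {α : ℝ≥0} (hα : 0 < α) {x : ℤ → PosReal}
    {p q : (ℤ → ℤ → PosReal) × (ℤ → ℤ → PosReal)} (hp : IsSolution (dKdV α 0) x p)
    (hq : IsSolution (dKdV α 0) x q) (t : ℕ) : p.1 t = q.1 t ∧ p.2 t = q.2 t := by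
  have hcar : ∀ t : ℤ, p.1 t = q.1 t → p.2 t = q.2 t := by
    intro t h
    have h1 : ∀ {p : (ℤ → ℤ → PosReal) × (ℤ → ℤ → PosReal)}, IsSolution (dKdV α 0) x p →
        IsCarrier (dKdV α 0) (fun n => (dKdV α 0 (p.1 t n, p.2 t (n - 1))).1) (p.2 (t + 1)) := by
      intro p hp
      simp only [hp.1 _ t]
      exact hp.isCarrier (t + 1)
    refine carrier_unique_of_isCarrier_next hα (hp.isCarrier t) (h ▸ hq.isCarrier t) (h1 hp)
      (w' := q.2 (t + 1)) ?_
    rw [h]; exact h1 hq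
  induction t with
  | zero =>
    have : p.1 0 = q.1 0 := funext fun n => (hp.2 n).trans (hq.2 n).symm
    exact ⟨this, hcar 0 this⟩
  | succ t ih =>
    have : p.1 (t + 1) = q.1 (t + 1) := by
      funext n
      have h1 := hp.1 n t
      rw [ih.1, ih.2, hq.1 n t] at h1
      exact (congrArg Prod.fst h1).symm
    push_cast
    exact ⟨this, hcar _ this⟩

/-- Negative times are the nonnegative times of the rotated solutions. -/
theorem IsSolution.eq {α : ℝ≥0} (hα : 0 < α) {x : ℤ → PosReal}
    {p q : (ℤ → ℤ → PosReal) × (ℤ → ℤ → PosReal)} (hp : IsSolution (dKdV α 0) x p)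
    (hq : IsSolution (dKdV α 0) x q) : p = q := by
  have hf := hp.eq_forward hα hq
  have hb := (hp.rotate (dKdV_involutive α 0)).eq_forward hα (hq.rotate (dKdV_involutive α 0))
  refine Prod.ext (funext fun t => ?_) (funext fun t => ?_)
  · obtain ⟨k, rfl | rfl⟩ := t.eq_nat_or_neg
    · exact (hf k).1
    · funext n
      simpa using congrFun (hb k).1 (-n)
  · rcases le_or_gt 0 t with h | h
    · obtain ⟨k, rfl⟩ := Int.eq_ofNat_of_zero_le h
      exact (hf k).2
    · obtain ⟨k, hk⟩ := Int.eq_ofNat_of_zero_le (show 0 ≤ -t - 1 by omega)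
      have ht : t = -(k : ℤ) - 1 := by omega
      subst ht
      funext n
      simpa using congrFun (hb k).2 (-n - 1)


/-! ### Carriers of `dKdV 0 α` -/

/-- The carrier recursion of `dKdV 0 α`. -/
def next (α : ℝ≥0) (y c : PosReal) : PosReal := (dKdV 0 α (y, c)).2

theorem coe_next (α : ℝ≥0) (y c : PosReal) : (next α y c : ℝ) = y / (1 + α * y * c) :=
  coe_dKdV_right_snd α y c

theorem continuous_next (α : ℝ≥0) : Continuous fun p : PosReal × PosReal => next α p.1 p.2 :=
  continuous_snd.comp (continuous_dKdV 0 α)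

theorem next_le (α : ℝ≥0) (y c : PosReal) : next α y c ≤ y := by
  have hy : (0 : ℝ) < y := y.2
  have hc : (0 : ℝ) < c := c.2
  rw [← Subtype.coe_le_coe, coe_next]
  exact div_le_self hy.le (by have : (0 : ℝ) ≤ α * y * c := by positivity
                              linarith)

theorem next_anti (α : ℝ≥0) (y : PosReal) {c c' : PosReal} (h : c ≤ c') :
    next α y c' ≤ next α y c := by
  have hy : (0 : ℝ) < y := y.2
  have hc : (0 : ℝ) < c := c.2
  have h' : (c : ℝ) ≤ c' := h
  rw [← Subtype.coe_le_coe, coe_next, coe_next]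
  gcongr

/-- The `k`-th approximation of the carrier. -/
def approx (α : ℝ≥0) : ℕ → (ℤ → PosReal) → ℤ → PosReal
  | 0, y, n => y n
  | k + 1, y, n => next α (y n) (approx α k y (n - 1))

theorem approx_succ (α : ℝ≥0) (k : ℕ) (y : ℤ → PosReal) (n : ℤ) :
    approx α (k + 1) y n = next α (y n) (approx α k y (n - 1)) := rfl

theorem measurable_approx (α : ℝ≥0) (k : ℕ) (n : ℤ) : Measurable fun y => approx α k y n := by
  induction k generalizing n with
  | zero => exact measurable_pi_apply n
  | succ k ih => exact (continuous_next α).measurable.comp ((measurable_pi_apply n).prodMk (ih _))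

theorem approx_congr (α : ℝ≥0) (k : ℕ) {y z : ℤ → PosReal} {n : ℤ} (h : ∀ j ≤ n, y j = z j) :
    approx α k y n = approx α k z n := by
  induction k generalizing n with
  | zero => exact h n le_rfl
  | succ k ih => simp only [approx]; rw [h n le_rfl, ih fun j hj => h j (by omega)]

theorem approx_le (α : ℝ≥0) (k : ℕ) (y : ℤ → PosReal) (n : ℤ) : approx α k y n ≤ y n := by
  cases k with
  | zero => exact le_rfl
  | succ k => exact next_le _ _ _

/-- A lower bound uniform in `k` keeps limits of the approximations inside `(0, ∞)`. -/
theorem le_approx (α : ℝ≥0) (k : ℕ) (y : ℤ → PosReal) (n : ℤ) :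
    next α (y n) (y (n - 1)) ≤ approx α k y n := by
  cases k with
  | zero => exact next_le _ _ _
  | succ k => exact next_anti _ _ (approx_le _ _ _ _)

/-- `next` reverses the order in the carrier, so two applications preserve it. -/
theorem approx_even_anti (α : ℝ≥0) (m : ℕ) (y : ℤ → PosReal) (n : ℤ) :
    approx α (2 * m + 2) y n ≤ approx α (2 * m) y n := by
  induction m generalizing n with
  | zero => exact approx_le _ _ _ _
  | succ m ih => exact next_anti _ _ (next_anti _ _ (ih _))

theorem approx_odd_mono (α : ℝ≥0) (m : ℕ) (y : ℤ → PosReal) (n : ℤ) :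
    approx α (2 * m + 1) y n ≤ approx α (2 * m + 3) y n :=
  next_anti _ _ (approx_even_anti _ _ _ _)

/-- Even and odd approximations are monotone but may have different limits, which `next` exchanges.
Tying the parity to that of `n` makes the limits a carrier for every `y`, without any recurrence. -/
theorem exists_tendsto_approx (α : ℝ≥0) (y : ℤ → PosReal) (n : ℤ) :
    ∃ l : PosReal, Tendsto (fun m : ℕ => approx α (2 * m + (n % 2).toNat) y n) atTop (𝓝 l) := by
  suffices h : ∃ l : ℝ, Tendsto
      (fun m : ℕ => (approx α (2 * m + (n % 2).toNat) y n : ℝ)) atTop (𝓝 l) by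
    obtain ⟨l, hl⟩ := h
    have hpos : (0 : ℝ) < l :=
      lt_of_lt_of_le (next α (y n) (y (n - 1))).2 (ge_of_tendsto' hl fun m => le_approx _ _ _ _)
    exact ⟨⟨l, hpos⟩, tendsto_subtype_rng.2 hl⟩
  rcases Int.emod_two_eq_zero_or_one n with h | h <;> rw [h]
  · exact ⟨_, tendsto_atTop_ciInf (antitone_nat_of_succ_le fun m => approx_even_anti α m y n)
      ⟨0, by rintro _ ⟨_, rfl⟩; exact (approx α _ y n).2.le⟩⟩
  · exact ⟨_, tendsto_atTop_ciSup (monotone_nat_of_le_succ fun m => approx_odd_mono α m y n)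
      ⟨y n, by rintro _ ⟨_, rfl⟩; exact approx_le _ _ _ _⟩⟩

/-- A measurable choice of a carrier of `dKdV 0 α`. -/
def car (α : ℝ≥0) (y : ℤ → PosReal) (n : ℤ) : PosReal := (exists_tendsto_approx α y n).choose

theorem tendsto_car (α : ℝ≥0) (y : ℤ → PosReal) (n : ℤ) :
    Tendsto (fun m : ℕ => approx α (2 * m + (n % 2).toNat) y n) atTop (𝓝 (car α y n)) :=
  (exists_tendsto_approx α y n).choose_spec

theorem measurable_car (α : ℝ≥0) (n : ℤ) : Measurable fun y => car α y n :=
  measurable_of_tendsto_metrizable (fun _ => measurable_approx α _ n)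
    (tendsto_pi_nhds.2 fun y => tendsto_car α y n)

theorem car_congr (α : ℝ≥0) {y z : ℤ → PosReal} {n : ℤ} (h : ∀ j ≤ n, y j = z j) :
    car α y n = car α z n := by
  have h1 := tendsto_car α y n
  simp only [approx_congr α _ h] at h1
  exact tendsto_nhds_unique h1 (tendsto_car α z n)

theorem next_car (α : ℝ≥0) (y : ℤ → PosReal) (n : ℤ) :
    next α (y n) (car α y (n - 1)) = car α y n := by
  have h1 : Tendsto (fun m : ℕ => next α (y n) (approx α (2 * m + ((n - 1) % 2).toNat) y (n - 1)))
      atTop (𝓝 (next α (y n) (car α y (n - 1)))) :=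
    Tendsto.comp (f := fun m : ℕ => (y n, approx α (2 * m + ((n - 1) % 2).toNat) y (n - 1)))
      ((continuous_next α).tendsto (y n, car α y (n - 1)))
      (tendsto_const_nhds.prodMk_nhds (tendsto_car α y (n - 1)))
  simp only [← approx_succ] at h1
  have h2 := tendsto_car α y n
  rcases Int.emod_two_eq_zero_or_one n with h | h
  · rw [show (n - 1) % 2 = 1 by omega] at h1
    rw [h] at h2
    -- For even `n` one step raises the index from `2m + 1` to `2(m + 1)`.
    exact tendsto_nhds_unique h1 (h2.comp (tendsto_add_atTop_nat 1))
  · rw [show (n - 1) % 2 = 0 by omega] at h1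
    rw [h] at h2
    exact tendsto_nhds_unique h1 h2

theorem isCarrier_car (α : ℝ≥0) (y : ℤ → PosReal) : IsCarrier (dKdV 0 α) y (car α y) :=
  next_car α y

/-! ### Contraction and uniqueness of carriers -/

/-- Products of neighbouring values are bounded along a sequence tending to `-∞`. -/
def Recurrent (α : ℝ≥0) (y : ℤ → PosReal) : Prop :=
  ∃ K : ℝ, ∀ n : ℤ, ∃ k ≤ n, (α : ℝ) * y k * y (k - 1) ≤ K

/-- `a` and `b` agree up to a factor `1 + e`. -/
def Near (e : ℝ) (a b : PosReal) : Prop := (a : ℝ) ≤ (1 + e) * b ∧ (b : ℝ) ≤ (1 + e) * a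

/-- A relative error `e` of the input becomes at most `e · αya / (1 + αya)`. Taking `s = e` gives
nonexpansion, and `s = K / (1 + K) * e` gives contraction. -/
theorem next_near_aux {α : ℝ≥0} {y a b : PosReal} {e s : ℝ}
    (hs : (α : ℝ) * y * a * e ≤ s * (1 + α * y * a)) (h : (b : ℝ) ≤ (1 + e) * a) : (next α y a : ℝ) ≤ (1 + s) * next α y b := by
  have hy : (0 : ℝ) < y := y.2
  have ha : (0 : ℝ) < a := a.2
  have hb : (0 : ℝ) < b := b.2
  rw [coe_next, coe_next, ← mul_div_assoc, div_le_div_iff₀ (by positivity) (by positivity)]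
  have h1 : (α : ℝ) * y * b ≤ α * y * ((1 + e) * a) := by gcongr
  have h2 : (1 : ℝ) + α * y * b ≤ (1 + s) * (1 + α * y * a) := by linarith
  calc (y : ℝ) * (1 + α * y * b) ≤ y * ((1 + s) * (1 + α * y * a)) := by gcongr
    _ = _ := by ring

theorem Near.next {α : ℝ≥0} {y a b : PosReal} {e : ℝ} (he : 0 ≤ e) (h : Near e a b) :
    Near e (next α y a) (next α y b) := by
  have hy : (0 : ℝ) < y := y.2
  exact ⟨next_near_aux (by linarith) h.2, next_near_aux (by linarith) h.1⟩

theorem Near.next_contract {α : ℝ≥0} {y z a b : PosReal} {e K : ℝ} (he : 0 ≤ e)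
    (hK : (α : ℝ) * y * z ≤ K) (ha : a ≤ z) (hb : b ≤ z) (h : Near e a b) :
    Near (K / (1 + K) * e) (DiscreteKdV.next α y a) (DiscreteKdV.next α y b) := by
  have hy : (0 : ℝ) < y := y.2
  have hz : (0 : ℝ) < z := z.2
  have hK0 : 0 ≤ K := le_trans (by positivity) hK
  have key : ∀ c : PosReal, c ≤ z → (α : ℝ) * y * c * e ≤ K / (1 + K) * e * (1 + α * y * c) := by
    intro c hc
    have hc' : (c : ℝ) ≤ z := hc
    have h1 : (α : ℝ) * y * c ≤ K := le_trans (by gcongr) hK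
    rw [div_mul_eq_mul_div, div_mul_eq_mul_div, le_div_iff₀ (by positivity)]
    nlinarith
  exact ⟨next_near_aux (key a ha) h.2, next_near_aux (key b hb) h.1⟩

/-- Both outputs lie between `y / (1 + K)` and `y`; this starts the contraction without any initial
closeness. -/
theorem near_next {α : ℝ≥0} {y z a b : PosReal} {K : ℝ} (hK : (α : ℝ) * y * z ≤ K) (ha : a ≤ z)
    (hb : b ≤ z) : Near K (next α y a) (next α y b) := by
  have hy : (0 : ℝ) < y := y.2
  have hz : (0 : ℝ) < z := z.2
  have hK0 : 0 ≤ K := le_trans (by positivity) hK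
  have key : ∀ c d : PosReal, c ≤ z → (next α y d : ℝ) ≤ (1 + K) * next α y c := by
    intro c d hc
    have hc0 : (0 : ℝ) < c := c.2
    have hc' : (c : ℝ) ≤ z := hc
    have h1 : (α : ℝ) * y * c ≤ K := le_trans (by gcongr) hK
    refine le_trans (next_le α y d) ?_
    rw [coe_next, ← mul_div_assoc, le_div_iff₀ (by positivity)]
    nlinarith
  exact ⟨key b a hb, key a b ha⟩

/-- `c` follows the carrier recursion strictly to the right of `m`. -/
def IsCarrierAfter (α : ℝ≥0) (y c : ℤ → PosReal) (m : ℤ) : Prop :=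
  ∀ n, m < n → next α (y n) (c (n - 1)) = c n

theorem IsCarrierAfter.near_of_le {α : ℝ≥0} {y a b : ℤ → PosReal} {m k n : ℤ} {e : ℝ}
    (he : 0 ≤ e) (ha : IsCarrierAfter α y a m) (hb : IsCarrierAfter α y b m) (hmk : m ≤ k)
    (hkn : k ≤ n) (h : Near e (a k) (b k)) : Near e (a n) (b n) := by
  induction n, hkn using Int.leInduction with
  | base => exact h
  | succ n hn ih =>
    rw [← ha (n + 1) (by omega), ← hb (n + 1) (by omega), add_sub_cancel_right]
    exact ih.next he

/-- Far to the right of their starting points, any two carriers are close to each other. -/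
theorem near_carriers {α : ℝ≥0} {y : ℤ → PosReal} {K : ℝ} (hK0 : 0 ≤ K)
    (hK : ∀ n : ℤ, ∃ k ≤ n, (α : ℝ) * y k * y (k - 1) ≤ K) (N : ℕ) (n : ℤ) :
    ∃ m₀ ≤ n, ∀ m ≤ m₀, ∀ a b, IsCarrierAfter α y a m → IsCarrierAfter α y b m →
      Near (K * (K / (1 + K)) ^ N) (a n) (b n) := by
  have hle : ∀ {a : ℤ → PosReal} {m j : ℤ}, IsCarrierAfter α y a m → m < j → a j ≤ y j := by
    intro a m j ha hj
    rw [← ha j hj]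
    exact next_le _ _ _
  induction N generalizing n with
  | zero =>
    obtain ⟨k, hk, hyk⟩ := hK n
    -- The recursion must already hold at `k - 1`, to give `a (k - 1) ≤ y (k - 1)`.
    refine ⟨k - 2, by omega, fun m hm a b ha hb => ?_⟩
    rw [pow_zero, mul_one]
    refine ha.near_of_le hK0 hb (by omega) hk ?_
    rw [← ha k (by omega), ← hb k (by omega)]
    exact near_next hyk (hle ha (by omega)) (hle hb (by omega))
  | succ N ih =>
    obtain ⟨k, hk, hyk⟩ := hK n
    obtain ⟨m₀, hm₀, h⟩ := ih (k - 1)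
    refine ⟨min m₀ (k - 2), by omega, fun m hm a b ha hb => ?_⟩
    refine ha.near_of_le (by positivity) hb (by omega) hk ?_
    rw [← ha k (by omega), ← hb k (by omega),
      show K * (K / (1 + K)) ^ (N + 1) = K / (1 + K) * (K * (K / (1 + K)) ^ N) by ring]
    exact Near.next_contract (by positivity) hyk (hle ha (by omega)) (hle hb (by omega))
      (h m (by omega) a b ha hb)

theorem tendsto_contraction {K : ℝ} (hK : 0 ≤ K) :
    Tendsto (fun N : ℕ => K * (K / (1 + K)) ^ N) atTop (𝓝 0) := by
  have := (tendsto_pow_atTop_nhds_zero_of_lt_one (div_nonneg hK (by positivity))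
    ((div_lt_one (by positivity)).2 (lt_one_add K))).const_mul K
  rwa [mul_zero] at this

theorem Recurrent.exists_nonneg {α : ℝ≥0} {y : ℤ → PosReal} (h : Recurrent α y) :
    ∃ K : ℝ, 0 ≤ K ∧ ∀ n : ℤ, ∃ k ≤ n, (α : ℝ) * y k * y (k - 1) ≤ K := by
  obtain ⟨K, hK⟩ := h
  refine ⟨K, ?_, hK⟩
  obtain ⟨k, -, hk⟩ := hK 0
  have h1 : (0 : ℝ) < y k := (y k).2
  have h2 : (0 : ℝ) < y (k - 1) := (y (k - 1)).2
  exact le_trans (by positivity) hk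

/-- The carrier is the limit of the carriers started far to the left. -/
theorem Recurrent.tendsto_of_isCarrierAfter {α : ℝ≥0} {y : ℤ → PosReal} (h : Recurrent α y)
    {a : ℕ → ℤ → PosReal} (ha : ∀ m : ℕ, IsCarrierAfter α y (a m) (-m)) {c : ℤ → PosReal}
    (hc : IsCarrier (dKdV 0 α) y c) (n : ℤ) : Tendsto (fun m => a m n) atTop (𝓝 (c n)) := by
  obtain ⟨K, hK0, hK⟩ := h.exists_nonneg
  rw [tendsto_subtype_rng, Metric.tendsto_atTop]
  intro ε hε
  have hcn : (0 : ℝ) < c n := (c n).2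
  have h1 := (tendsto_contraction hK0).mul_const (2 * (c n : ℝ))
  have h2 := tendsto_contraction hK0
  rw [zero_mul] at h1
  obtain ⟨N, hN, hN1⟩ := ((h1.eventually_lt_const hε).and (h2.eventually_lt_const one_pos)).exists
  have he0 : 0 ≤ K * (K / (1 + K)) ^ N := by positivity
  obtain ⟨m₀, -, h⟩ := near_carriers hK0 hK N n
  refine ⟨(-m₀).toNat, fun m hm => ?_⟩
  obtain ⟨h3, h4⟩ := h (-m) (by omega) (a m) c (ha m) fun k _ => hc k
  -- A relative error `e < 1` turns into an absolute error of at most `2 e c_n < ε`.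
  have h5 : (a m n : ℝ) ≤ 2 * c n := by nlinarith
  rw [Real.dist_eq, abs_lt]
  constructor <;> nlinarith

theorem Recurrent.carrier_eq {α : ℝ≥0} {y : ℤ → PosReal} (h : Recurrent α y) {c : ℤ → PosReal}
    (hc : IsCarrier (dKdV 0 α) y c) : c = car α y :=
  funext fun n => tendsto_nhds_unique tendsto_const_nhds
    (h.tendsto_of_isCarrierAfter (a := fun _ => c) (fun _ k _ => hc k) (isCarrier_car α y) n)

theorem Recurrent.mem_uniqueCarrierSet {α : ℝ≥0} {y : ℤ → PosReal} (h : Recurrent α y) :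
    y ∈ uniqueCarrierSet (dKdV 0 α) :=
  ⟨car α y, isCarrier_car α y, fun _ hc => h.carrier_eq hc⟩


/-! ### General measure theory -/

section General

theorem measurePreserving_reindex {ι κ X : Type*} [MeasurableSpace X] (μ : Measure X)
    [IsProbabilityMeasure μ] {f : κ → ι} (hf : Function.Injective f) :
    MeasurePreserving (fun (y : ι → X) k => y (f k)) (Measure.infinitePi fun _ => μ)
      (Measure.infinitePi fun _ => μ) :=
  ⟨by fun_prop, Measure.map_infinitePi_infinitePi_of_inj (P := fun _ : ι => μ) hf⟩

/-- The shift to the left on two-sided sequences. -/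
def shift {X : Type*} (y : ℤ → X) : ℤ → X := fun n => y (n + 1)

theorem shift_iterate {X : Type*} (n : ℕ) (y : ℤ → X) (k : ℤ) : shift^[n] y k = y (k + n) := by
  induction n generalizing y with
  | zero => simp
  | succ n ih =>
    rw [Function.iterate_succ_apply, ih]
    simp only [shift]
    push_cast
    rw [add_assoc]

theorem measurePreserving_shift {X : Type*} [MeasurableSpace X] (μ : Measure X)
    [IsProbabilityMeasure μ] :
    MeasurePreserving (shift (X := X)) (Measure.infinitePi fun _ => μ)
      (Measure.infinitePi fun _ => μ) :=
  measurePreserving_reindex μ (add_left_injective 1)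

/-- A large shift moves the finitely many coordinates of the cylinder off themselves, so the two
events are independent. -/
theorem measureReal_cylinder_inter_shift {X : Type*} [MeasurableSpace X] (μ : Measure X)
    [IsProbabilityMeasure μ] (I : Finset ℤ) {S : Set (I → X)} (hS : MeasurableSet S) :
    ∃ n : ℕ, (Measure.infinitePi fun _ : ℤ => μ).real
      (cylinder I S ∩ shift^[n] ⁻¹' cylinder I S) =
        (Measure.infinitePi fun _ : ℤ => μ).real (cylinder I S) ^ 2 := by
  classical
  obtain ⟨N, hN⟩ : ∃ N : ℕ, ∀ i ∈ I, |i| < N := by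
    refine ⟨I.sup Int.natAbs + 1, fun i hi => ?_⟩
    have := Finset.le_sup (f := Int.natAbs) hi
    rw [Int.abs_eq_natAbs]
    omega
  refine ⟨2 * N, ?_⟩
  set P := Measure.infinitePi fun _ : ℤ => μ
  have hmp : MeasurePreserving (shift^[2 * N]) P P := (measurePreserving_shift μ).iterate _
  have hB : MeasurableSet (cylinder (α := fun _ : ℤ => X) I S) := MeasurableSet.cylinder I hS
  set J : Finset ℤ := I.map (addRightEmbedding (2 * N : ℤ))
  have hdisj : Disjoint I J := by
    rw [Finset.disjoint_left]
    intro i hi hj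
    obtain ⟨k, hk, rfl⟩ := Finset.mem_map.1 hj
    have h1 := hN _ hi
    have h2 := hN _ hk
    rw [abs_lt] at h1 h2
    simp only [addRightEmbedding_apply] at h1
    omega
  have hind := (iIndepFun_infinitePi (P := fun _ : ℤ => μ) (X := fun _ => id)
    (fun _ => measurable_id)).indepFun_finset I J hdisj (fun i => measurable_pi_apply i)
  set T : Set (J → X) := {z | (fun i : I => z ⟨i + 2 * N, Finset.mem_map_of_mem _ i.2⟩) ∈ S}
  have hT : MeasurableSet T := (measurable_pi_lambda _ fun i => measurable_pi_apply _) hS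
  have h := hind.measure_inter_preimage_eq_mul S T hS hT
  have hBn : (fun (a : ℤ → X) (i : J) => id (a i)) ⁻¹' T = shift^[2 * N] ⁻¹' cylinder I S := by
    ext y
    simp only [T, Set.mem_preimage, Set.mem_ofPred_eq, mem_cylinder, id]
    have : (fun i : I => y (i + 2 * N)) = I.restrict (shift^[2 * N] y) := by
      funext i
      simp [shift_iterate]
    rw [this]
  rw [hBn] at h
  have h' : P (cylinder I S ∩ shift^[2 * N] ⁻¹' cylinder I S) =
      P (cylinder I S) * P (shift^[2 * N] ⁻¹' cylinder I S) := h
  rw [hmp.measure_preimage hB.nullMeasurableSet] at h'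
  rw [measureReal_def, h', ENNReal.toReal_mul, sq, measureReal_def]

open scoped symmDiff in
/-- Bernoulli shifts are ergodic. -/
theorem ergodic_shift {X : Type*} [MeasurableSpace X] (μ : Measure X) [IsProbabilityMeasure μ] :
    Ergodic (shift (X := X)) (Measure.infinitePi fun _ => μ) := by
  refine ⟨measurePreserving_shift μ, ⟨fun {s} hs hinv => ?_⟩⟩
  set P := Measure.infinitePi fun _ : ℤ => μ
  set p := P.real s
  have hp0 : 0 ≤ p := measureReal_nonneg
  have hp1 : p ≤ 1 := measureReal_le_one
  -- If a cylinder `B` is `ε`-close to the invariant set `s`, so is its shift; hence `p` is within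
  -- `2ε` of `P(B)²`, itself within `2ε` of `p²`.
  have key : ∀ ε : ℝ, 0 < ε → |p - p ^ 2| ≤ 4 * ε := by
    intro ε hε
    obtain ⟨B, hB, hsB⟩ := (Measure.MeasureDense.of_generateFrom_isSetAlgebra_finite P
      isSetAlgebra_measurableCylinders generateFrom_measurableCylinders.symm).approx s hs
      (measure_ne_top _ _) ε hε
    obtain ⟨I, S, hS, rfl⟩ := (mem_measurableCylinders _).1 hB
    set B := cylinder (α := fun _ : ℤ => X) I S
    have hBm : MeasurableSet B := MeasurableSet.cylinder I hS
    obtain ⟨n, hn⟩ := measureReal_cylinder_inter_shift μ I hS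
    have hmp : MeasurePreserving (shift^[n]) P P := (measurePreserving_shift μ).iterate _
    have hsn : shift^[n] ⁻¹' s = s := Function.IsFixedPt.preimage_iterate hinv n
    have h1 : P.real (s ∆ B) ≤ ε :=
      ENNReal.toReal_le_of_le_ofReal hε.le hsB.le
    have h2 : P.real (s ∆ (shift^[n] ⁻¹' B)) = P.real (s ∆ B) := by
      conv_lhs => rw [← hsn, ← Set.preimage_symmDiff]
      exact hmp.measureReal_preimage (hs.symmDiff hBm).nullMeasurableSet
    have h3 : P.real (s ∆ (B ∩ shift^[n] ⁻¹' B)) ≤ 2 * ε := by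
      have hsub : s ∆ (B ∩ shift^[n] ⁻¹' B) ⊆ s ∆ B ∪ s ∆ (shift^[n] ⁻¹' B) := by
        intro y
        simp only [Set.mem_symmDiff, Set.mem_inter_iff, Set.mem_union]
        tauto
      calc _ ≤ P.real (s ∆ B ∪ s ∆ (shift^[n] ⁻¹' B)) := measureReal_mono hsub
        _ ≤ P.real (s ∆ B) + P.real (s ∆ (shift^[n] ⁻¹' B)) := measureReal_union_le _ _
        _ ≤ 2 * ε := by rw [h2]; linarith
    have h4 := abs_measureReal_sub_le_measureReal_symmDiff (μ := P) hs.nullMeasurableSet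
      (hBm.inter (hmp.measurable hBm)).nullMeasurableSet
    have h5 := abs_measureReal_sub_le_measureReal_symmDiff (μ := P) hs.nullMeasurableSet
      hBm.nullMeasurableSet
    rw [hn] at h4
    have hb0 : 0 ≤ P.real B := measureReal_nonneg
    have hb1 : P.real B ≤ 1 := measureReal_le_one
    have h4' := abs_le.1 (h4.trans h3)
    have h5' := abs_le.1 (h5.trans h1)
    change -(2 * ε) ≤ p - P.real B ^ 2 ∧ p - P.real B ^ 2 ≤ 2 * ε at h4'
    change -ε ≤ p - P.real B ∧ p - P.real B ≤ ε at h5'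
    rw [abs_le]
    constructor <;> nlinarith
  have hpp : p - p ^ 2 = 0 := by
    by_contra hne
    have := key (|p - p ^ 2| / 8) (by positivity)
    have := abs_pos.2 hne
    linarith
  have hcases : p = 0 ∨ p = 1 := by
    have : p * (1 - p) = 0 := by linarith
    rcases mul_eq_zero.1 this with h | h
    · exact Or.inl h
    · exact Or.inr (by linarith)
  rw [eventuallyConst_set]
  rcases hcases with h | h
  · right
    exact measure_eq_zero_iff_ae_notMem.1 ((measureReal_eq_zero_iff (measure_ne_top _ _)).1 h)
  · left
    refine (mem_ae_iff_prob_eq_one hs).2 ?_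
    rw [← ENNReal.toReal_eq_one_iff]
    exact h

/-- A factor of an ergodic system is ergodic. -/
theorem ergodic_of_ae_semiconj {Ω Ω' : Type*} [MeasurableSpace Ω] [MeasurableSpace Ω']
    {P : Measure Ω} {P' : Measure Ω'} {f : Ω → Ω} {g : Ω' → Ω'} {φ : Ω → Ω'}
    (hφ : MeasurePreserving φ P P') (hf : Ergodic f P) (hg : Measurable g)
    (h : ∀ᵐ y ∂P, g (φ y) = φ (f y)) : Ergodic g P' := by
  refine ⟨⟨hg, ?_⟩, ⟨fun {s} hs hinv => ?_⟩⟩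
  · conv_lhs => rw [← hφ.map_eq]
    rw [Measure.map_map hg hφ.measurable, show P.map (g ∘ φ) = P.map (φ ∘ f) from Measure.map_congr h,
      ← Measure.map_map hφ.measurable hf.measurable, hf.map_eq, hφ.map_eq]
  · have hae : f ⁻¹' (φ ⁻¹' s) =ᵐ[P] φ ⁻¹' s := by
      filter_upwards [h] with y hy
      have : (φ (f y) ∈ s) = (φ y ∈ s) := by
        rw [← hy]
        exact congrArg (φ y ∈ ·) hinv
      exact this
    have hc := hf.quasiErgodic.aeconst_set₀ (hφ.measurable hs).nullMeasurableSet hae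
    rw [eventuallyConst_set] at hc ⊢
    rw [← hφ.map_eq]
    exact hc.imp (ae_map_iff hφ.aemeasurable hs).2 (ae_map_iff hφ.aemeasurable hs.compl).2

/-- Almost everywhere limits of random variables with a common law have this law. -/
theorem map_eq_of_tendsto {Ω E : Type*} [MeasurableSpace Ω] [MeasurableSpace E]
    [TopologicalSpace E] [HasOuterApproxClosed E] [BorelSpace E] {P : Measure Ω}
    [IsProbabilityMeasure P] {Q : Measure E} {f : ℕ → Ω → E} {g : Ω → E}
    (hf : ∀ m, MeasurePreserving (f m) P Q) (hg : Measurable g)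
    (h : ∀ᵐ ω ∂P, Tendsto (fun m => f m ω) atTop (𝓝 (g ω))) : MeasurePreserving g P Q := by
  have hQ : IsProbabilityMeasure Q := by
    rw [← (hf 0).map_eq]
    exact Measure.isProbabilityMeasure_map (hf 0).aemeasurable
  have : IsProbabilityMeasure (P.map g) := Measure.isProbabilityMeasure_map hg.aemeasurable
  refine ⟨hg, ext_of_forall_integral_eq_of_IsFiniteMeasure fun F => ?_⟩
  have hF : Measurable F := F.continuous.measurable
  have h1 : Tendsto (fun m => ∫ ω, F (f m ω) ∂P) atTop (𝓝 (∫ ω, F (g ω) ∂P)) := by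
    refine tendsto_integral_of_dominated_convergence (fun _ => ‖F‖)
      (fun m => (hF.comp (hf m).measurable).aestronglyMeasurable) (integrable_const _)
      (fun m => ae_of_all _ fun ω => F.norm_coe_le_norm _) ?_
    filter_upwards [h] with ω hω
    exact (F.continuous.tendsto _).comp hω
  have h2 : ∀ m, ∫ ω, F (f m ω) ∂P = ∫ x, F x ∂Q := fun m => by
    rw [← (hf m).map_eq, integral_map (hf m).aemeasurable hF.aestronglyMeasurable]
  rw [integral_map hg.aemeasurable hF.aestronglyMeasurable]
  simp only [h2] at h1
  exact tendsto_nhds_unique h1 tendsto_const_nhds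

/-- A map preserving the joint law of two coordinates preserves the product measure when it acts on
these coordinates. -/
theorem measurePreserving_update_update {ι X : Type*} [DecidableEq ι] [MeasurableSpace X]
    (μ : ι → Measure X) [∀ i, IsProbabilityMeasure (μ i)] {i j : ι} (hij : i ≠ j)
    {g : X × X → X × X} (hg : MeasurePreserving g ((μ i).prod (μ j)) ((μ i).prod (μ j))) :
    MeasurePreserving
      (fun z => Function.update (Function.update z i (g (z i, z j)).1) j (g (z i, z j)).2)
      (Measure.infinitePi μ) (Measure.infinitePi μ) := by
  have hgm := hg.measurable
  have hgij : Measurable fun z : ι → X => g (z i, z j) :=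
    hgm.comp ((measurable_pi_apply i).prodMk (measurable_pi_apply j))
  have hmeas : Measurable fun z : ι → X =>
      Function.update (Function.update z i (g (z i, z j)).1) j (g (z i, z j)).2 := by
    refine measurable_pi_lambda _ fun l => ?_
    simp only [Function.update_apply]
    split_ifs
    · exact hgij.snd
    · exact hgij.fst
    · exact measurable_pi_apply l
  refine ⟨hmeas, Measure.eq_infinitePi _ fun s t ht => ?_⟩
  rw [Measure.map_apply hmeas (MeasurableSet.pi s.countable_toSet fun l _ => ht l)]
  set r := (s.erase i).erase j with hr
  -- Filling in the whole space off `s` splits the box into a condition on `(i, j)` and one on the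
  -- rest, whether or not `i, j ∈ s`.
  set t' : ι → Set X := fun l => if l ∈ s then t l else Set.univ with ht'
  have htm : ∀ l, MeasurableSet (t' l) := fun l => by
    simp only [t']
    split_ifs
    exacts [ht l, .univ]
  have hpre : (fun z : ι → X =>
      Function.update (Function.update z i (g (z i, z j)).1) j (g (z i, z j)).2) ⁻¹'
        Set.pi s t = (fun z => g (z i, z j)) ⁻¹' (t' i ×ˢ t' j) ∩ Set.pi r t := by
    ext z
    simp only [Set.mem_preimage, Set.mem_pi, Set.mem_inter_iff, Set.mem_prod, t', Finset.mem_coe,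
      Function.update_apply, hr, Finset.mem_erase]
    constructor
    · intro h
      refine ⟨⟨?_, ?_⟩, fun l ⟨h1, h2, h3⟩ => by simpa [h1, h2] using h l h3⟩
      · split_ifs with hi
        · simpa [hij] using h i hi
        · trivial
      · split_ifs with hj
        · simpa using h j hj
        · trivial
    · rintro ⟨⟨h1, h2⟩, h3⟩ l hl
      split_ifs with hlj hli
      · subst hlj; rwa [if_pos hl] at h2
      · subst hli; rwa [if_pos hl] at h1
      · exact h3 l ⟨hlj, hli, hl⟩
  have hdisj : Disjoint ({i, j} : Finset ι) r := by
    simp [Finset.disjoint_left, hr]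
  have hind := ((iIndepFun_infinitePi (P := μ) (X := fun _ => id)
    (fun _ => measurable_id)).indepFun_finset {i, j} r hdisj
      (fun l => measurable_pi_apply l)).measure_inter_preimage_eq_mul
      ((fun z => g (z ⟨i, by simp⟩, z ⟨j, by simp⟩)) ⁻¹' (t' i ×ˢ t' j))
      (Set.pi Set.univ fun l : r => t l)
      ((hgm.comp ((measurable_pi_apply _).prodMk (measurable_pi_apply _)))
        ((htm i).prod (htm j))) (MeasurableSet.univ_pi fun l => ht l)
  have hset : (fun (a : ι → X) (l : r) => id (a l)) ⁻¹' (Set.pi Set.univ fun l : r => t l) =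
      Set.pi r t := by
    ext z
    simp [Set.mem_pi]
  rw [hset] at hind
  rw [hpre]
  refine hind.trans ?_
  have hpair : Measure.infinitePi μ ((fun z => g (z i, z j)) ⁻¹' (t' i ×ˢ t' j)) =
      μ i (t' i) * μ j (t' j) := by
    have h1 : (fun z : ι → X => g (z i, z j)) ⁻¹' (t' i ×ˢ t' j) =
        (fun z : ι → X => (z i, z j)) ⁻¹' (g ⁻¹' (t' i ×ˢ t' j)) := rfl
    rw [h1, ← Measure.map_apply (by fun_prop) (hgm ((htm i).prod (htm j))),
      Measure.infinitePi_map_eval_prod hij,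
      hg.measure_preimage ((htm i).prod (htm j)).nullMeasurableSet, Measure.prod_prod]
  rw [Measure.infinitePi_pi _ fun l _ => ht l]
  refine (congrArg (· * _) hpair).trans ?_
  have hprod : ∏ l ∈ s, μ l (t l) = ∏ l ∈ insert i (insert j r), μ l (t' l) := by
    rw [Finset.prod_congr rfl fun l hl => show μ l (t l) = μ l (t' l) by simp [t', hl]]
    refine Finset.prod_subset (fun l hl => ?_) fun l _ hl => by simp [t', hl]
    simp only [hr, Finset.mem_insert, Finset.mem_erase]
    tauto
  rw [hprod, Finset.prod_insert (by simp [hr, hij]), Finset.prod_insert (by simp [hr]), mul_assoc]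
  congr 2
  refine Finset.prod_congr rfl fun l hl => ?_
  have hl' : l ∈ s := Finset.mem_of_mem_erase (Finset.mem_of_mem_erase hl)
  simp [t', hl']

/-- A measurable map that is injective on a conull set has a measurable left inverse there. -/
theorem exists_measurable_leftInverse {Ω Ω' : Type*} [MeasurableSpace Ω] [StandardBorelSpace Ω]
    [Nonempty Ω] [MeasurableSpace Ω'] [MeasurableSpace.CountablySeparated Ω'] {P : Measure Ω}
    {φ : Ω → Ω'} (hφ : Measurable φ) {A : Set Ω} (hA : ∀ᵐ y ∂P, y ∈ A) (hinj : Set.InjOn φ A) :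
    ∃ ψ : Ω' → Ω, Measurable ψ ∧ (∀ᵐ y ∂P, ψ (φ y) = y) ∧
      ∀ᵐ x ∂P.map φ, ∃ y ∈ A, φ y = x ∧ ψ x = y := by
  obtain ⟨N, hAN, hN, hN0⟩ := exists_measurable_superset_of_null (ae_iff.1 hA)
  have hB : MeasurableSet Nᶜ := hN.compl
  have hBA : Nᶜ ⊆ A := fun y hy => by
    by_contra h
    exact hy (hAN h)
  have hBae : ∀ᵐ y ∂P, y ∈ Nᶜ := measure_eq_zero_iff_ae_notMem.1 hN0
  have : StandardBorelSpace (Nᶜ : Set Ω) := hB.standardBorel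
  -- Lusin–Souslin: injective measurable images of Borel sets are measurable.
  have hemb : MeasurableEmbedding fun y : (Nᶜ : Set Ω) => φ y :=
    (hφ.comp measurable_subtype_coe).measurableEmbedding
      fun y z h => Subtype.ext (hinj (hBA y.2) (hBA z.2) h)
  obtain ⟨ψ, hψ, hψφ⟩ := hemb.exists_measurable_extend measurable_subtype_coe
    fun _ => inferInstance
  have hinv : ∀ y ∈ Nᶜ, ψ (φ y) = y := fun y hy => congrFun hψφ ⟨y, hy⟩
  refine ⟨ψ, hψ, hBae.mono hinv, ?_⟩
  have him : MeasurableSet (φ '' Nᶜ) := hB.image_of_measurable_injOn hφ (hinj.mono hBA)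
  have : ∀ᵐ x ∂P.map φ, x ∈ φ '' Nᶜ :=
    (ae_map_iff hφ.aemeasurable him).2 (hBae.mono fun y hy => Set.mem_image_of_mem φ hy)
  filter_upwards [this]
  rintro _ ⟨y, hy, rfl⟩
  exact ⟨y, hBA hy, rfl, hinv y hy⟩

end General


/-! ### Invariance of `GIG × IG` under `dKdV α 0` -/

/-- The exponential function with values in `(0, ∞)`. -/
def expPos (s : ℝ) : PosReal := ⟨Real.exp s, Real.exp_pos s⟩

theorem measurable_expPos : Measurable expPos := Real.measurable_exp.subtype_mk

/-- The measure `dx / x` on `(0, ∞)`. -/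
def haarPos : Measure PosReal := (volume : Measure ℝ).map expPos

instance : SFinite haarPos := by unfold haarPos; infer_instance

/-- Substitution `x = e^s`; the factor `x` is its Jacobian. -/
theorem comap_withDensity_eq {f : ℝ → ℝ} (hf : Measurable f) :
    (Measure.comap (Subtype.val : PosReal → ℝ) volume).withDensity
      (fun x => ENNReal.ofReal (f x)) =
    haarPos.withDensity fun x => ENNReal.ofReal (x * f x) := by
  have hfm : Measurable fun x : PosReal => ENNReal.ofReal (x * f x) := by fun_prop
  have he : MeasurableSet (Set.Ioi (0 : ℝ)) := measurableSet_Ioi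
  ext A hA
  have hpre : MeasurableSet (expPos ⁻¹' A) := measurable_expPos hA
  have himg : ((↑) : PosReal → ℝ) '' A = Real.exp '' (expPos ⁻¹' A) := by
    ext x
    constructor
    · rintro ⟨y, hy, rfl⟩
      have hlog : expPos (Real.log y) = y := Subtype.ext (Real.exp_log y.2)
      exact ⟨Real.log y, by rwa [Set.mem_preimage, hlog], Real.exp_log y.2⟩
    · rintro ⟨s, hs, rfl⟩
      exact ⟨expPos s, hs, rfl⟩
  rw [withDensity_apply _ hA, withDensity_apply _ hA, haarPos,
    setLIntegral_map hA hfm measurable_expPos,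
    setLIntegral_subtype he A (fun x => ENNReal.ofReal (f x)), himg,
    lintegral_image_eq_lintegral_abs_deriv_mul hpre
      (fun s _ => (Real.hasDerivAt_exp s).hasDerivWithinAt) Real.exp_injective.injOn]
  refine lintegral_congr fun s => ?_
  rw [abs_of_pos (Real.exp_pos s), ← ENNReal.ofReal_mul (Real.exp_pos s).le]
  rfl

theorem normalizedDensity_eq {f : ℝ → ℝ} (hf : Measurable f) : ∃ κ : ENNReal,
    normalizedDensity f = κ • haarPos.withDensity fun x => ENNReal.ofReal (x * f x) :=
  ⟨_, by rw [← comap_withDensity_eq hf]; rfl⟩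

theorem isProbabilityMeasure_normalizedDensity {f : ℝ → ℝ} (hf : Measurable f)
    (hpos : ∀ x, 0 < x → 0 < f x) (hint : ∫⁻ x in Set.Ioi 0, ENNReal.ofReal (f x) < ⊤) :
    IsProbabilityMeasure (normalizedDensity f) := by
  have he : MeasurableSet (Set.Ioi (0 : ℝ)) := measurableSet_Ioi
  have huniv : (Measure.comap (Subtype.val : PosReal → ℝ) volume).withDensity
      (fun x => ENNReal.ofReal (f x)) Set.univ = ∫⁻ x in Set.Ioi 0, ENNReal.ofReal (f x) := by
    rw [withDensity_apply _ .univ, Measure.restrict_univ]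
    exact lintegral_subtype_comap he fun x => ENNReal.ofReal (f x)
  refine ⟨?_⟩
  rw [normalizedDensity, Measure.smul_apply, huniv, smul_eq_mul]
  refine ENNReal.inv_mul_cancel ?_ hint.ne
  rw [← pos_iff_ne_zero, setLIntegral_pos_iff (by fun_prop)]
  have : Function.support (fun x => ENNReal.ofReal (f x)) ∩ Set.Ioi 0 = Set.Ioi 0 := by
    refine Set.inter_eq_right.2 fun x hx => ?_
    simpa using hpos x hx
  rw [this]
  simp

/-- Near `0` the exponential beats every power; on `(1, ∞)` the power alone is integrable because
`lam > 0`. -/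
theorem lintegral_invGamma_lt_top {lam c : ℝ} (hlam : 0 < lam) (hc : 0 < c) :
    ∫⁻ x in Set.Ioi (0 : ℝ), ENNReal.ofReal (x ^ (-lam - 1) * Real.exp (-c * x⁻¹)) < ⊤ := by
  rw [← Set.Ioc_union_Ioi_eq_Ioi (zero_le_one (α := ℝ))]
  refine (lintegral_union_le _ _ _).trans_lt (ENNReal.add_lt_top.2 ⟨?_, ?_⟩)
  · obtain ⟨k, hk⟩ := exists_nat_ge (lam + 1)
    have hb : ∀ x ∈ Set.Ioc (0 : ℝ) 1,
        ENNReal.ofReal (x ^ (-lam - 1) * Real.exp (-c * x⁻¹)) ≤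
          ENNReal.ofReal (k.factorial / c ^ k) := by
      rintro x ⟨hx0, hx1⟩
      refine ENNReal.ofReal_le_ofReal ?_
      have h1 : (c * x⁻¹) ^ k / k.factorial ≤ Real.exp (c * x⁻¹) :=
        Real.pow_div_factorial_le_exp _ (by positivity) k
      have h2 : Real.exp (-c * x⁻¹) ≤ k.factorial / c ^ k * x ^ k := by
        rw [neg_mul, Real.exp_neg]
        calc (Real.exp (c * x⁻¹))⁻¹ ≤ ((c * x⁻¹) ^ k / k.factorial)⁻¹ :=
              inv_anti₀ (by positivity) h1
          _ = _ := by rw [mul_pow, inv_pow]; field_simp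
      have h3 : x ^ (-lam - 1) * x ^ k ≤ 1 := by
        rw [← Real.rpow_natCast, ← Real.rpow_add hx0]
        exact Real.rpow_le_one hx0.le hx1 (by linarith)
      calc x ^ (-lam - 1) * Real.exp (-c * x⁻¹)
          ≤ x ^ (-lam - 1) * (k.factorial / c ^ k * x ^ k) := by gcongr
        _ = k.factorial / c ^ k * (x ^ (-lam - 1) * x ^ k) := by ring
        _ ≤ k.factorial / c ^ k * 1 := by gcongr
        _ = _ := mul_one _
    refine (setLIntegral_mono' measurableSet_Ioc hb).trans_lt ?_
    rw [setLIntegral_const]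
    exact ENNReal.mul_lt_top ENNReal.ofReal_lt_top (by simp)
  · have hb : ∀ x ∈ Set.Ioi (1 : ℝ),
        ENNReal.ofReal (x ^ (-lam - 1) * Real.exp (-c * x⁻¹)) ≤
          ENNReal.ofReal (x ^ (-lam - 1)) := by
      intro x hx
      have hx0 : (0 : ℝ) < x := one_pos.trans hx
      refine ENNReal.ofReal_le_ofReal (mul_le_of_le_one_right (by positivity) ?_)
      rw [Real.exp_le_one_iff]
      have : 0 < c * x⁻¹ := by positivity
      linarith
    refine (setLIntegral_mono' measurableSet_Ioi hb).trans_lt ?_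
    have hi : IntegrableOn (fun x : ℝ => x ^ (-lam - 1)) (Set.Ioi 1) :=
      integrableOn_Ioi_rpow_of_lt (by linarith) one_pos
    exact hi.lintegral_lt_top

theorem isProbabilityMeasure_invGamma {lam c : ℝ} (hlam : 0 < lam) (hc : 0 < c) :
    IsProbabilityMeasure (invGamma lam c) :=
  isProbabilityMeasure_normalizedDensity (by fun_prop) (fun x hx => by positivity)
    (lintegral_invGamma_lt_top hlam hc)

theorem isProbabilityMeasure_genInvGaussian {lam c₁ c₂ : ℝ} (hlam : 0 < lam) (hc₁ : 0 ≤ c₁)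
    (hc₂ : 0 < c₂) : IsProbabilityMeasure (genInvGaussian lam c₁ c₂) := by
  refine isProbabilityMeasure_normalizedDensity (by fun_prop) (fun x hx => by positivity)
    (lt_of_le_of_lt ?_ (lintegral_invGamma_lt_top hlam hc₂))
  refine setLIntegral_mono' measurableSet_Ioi fun x hx => ENNReal.ofReal_le_ofReal ?_
  have hx0 : (0 : ℝ) < x := hx
  have : 0 ≤ c₁ * x := by positivity
  gcongr
  linarith

theorem measurePreserving_withDensity {Ω : Type*} [MeasurableSpace Ω] {m : Measure Ω} {T : Ω → Ω}
    (hT : MeasurePreserving T m m) {w : Ω → ENNReal} (hw : Measurable w)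
    (hwT : ∀ ω, w (T ω) = w ω) : MeasurePreserving T (m.withDensity w) (m.withDensity w) := by
  refine ⟨hT.measurable, ?_⟩
  ext A hA
  rw [Measure.map_apply hT.measurable hA, withDensity_apply _ hA,
    withDensity_apply _ (hT.measurable hA), ← hT.setLIntegral_comp_preimage hA hw]
  simp only [hwT]

/-- In logarithmic coordinates the map is `(a, b) ↦ (b - L(a + b), a + L(a + b))` with `L(s) = log
(1 + α e^s)`, a composition of shears, swaps and fibrewise reflections. -/
theorem measurePreserving_dKdV_haarPos (α : ℝ≥0) :
    MeasurePreserving (dKdV α 0) (haarPos.prod haarPos) (haarPos.prod haarPos) := by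
  have hpos : ∀ s, 0 < 1 + (α : ℝ) * Real.exp s := fun s => by positivity
  have hlog : Measurable fun s : ℝ => Real.log (1 + α * Real.exp s) := by fun_prop
  have h1 := measurePreserving_prod_add (volume : Measure ℝ) (volume : Measure ℝ)
  have h2 := Measure.measurePreserving_swap (μ := (volume : Measure ℝ)) (ν := (volume : Measure ℝ))
  have h3 : MeasurePreserving
      (fun p : ℝ × ℝ => (p.1, (p.1 - Real.log (1 + α * Real.exp p.1)) - p.2))
      ((volume : Measure ℝ).prod volume) ((volume : Measure ℝ).prod volume) :=
    (MeasurePreserving.id _).skew_product (g := fun s a => (s - Real.log (1 + α * Real.exp s)) - a)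
      (by unfold Function.uncurry; fun_prop)
      (ae_of_all _ fun s => (Measure.measurePreserving_sub_left volume _).map_eq)
  have h4 := measurePreserving_prod_neg_add (volume : Measure ℝ) (volume : Measure ℝ)
  have h := h4.comp (h2.comp (h3.comp (h2.comp h1)))
  have hmeas : Measurable (dKdV α 0) := (continuous_dKdV α 0).measurable
  refine ⟨hmeas, ?_⟩
  have he := measurable_expPos.prodMap measurable_expPos
  rw [haarPos, Measure.map_prod_map _ _ measurable_expPos measurable_expPos,
    Measure.map_map hmeas he]
  conv_rhs => rw [← h.map_eq, Measure.map_map he h.measurable]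
  congr 1
  funext ⟨a, b⟩
  have hab := hpos (a + b)
  refine Prod.ext (Subtype.ext ?_) (Subtype.ext ?_)
  · simp only [Function.comp, Prod.map, coe_dKdV_left_fst, Prod.swap, expPos]
    rw [Real.exp_sub, Real.exp_sub, Real.exp_log hab, Real.exp_add, ← mul_assoc]
    field_simp
  · simp only [Function.comp, Prod.map, coe_dKdV_left_snd, Prod.swap, expPos]
    rw [show -(a + b - Real.log (1 + α * Real.exp (a + b)) - a) + (a + b) =
      a + Real.log (1 + α * Real.exp (a + b)) by ring, Real.exp_add a (Real.log _),
      Real.exp_log hab, Real.exp_add, ← mul_assoc]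

/-- Detailed balance for the modified discrete KdV map. -/
theorem measurePreserving_dKdV {α : ℝ≥0} {lam c : ℝ} (hlam : 0 < lam) (hc : 0 < c) :
    MeasurePreserving (dKdV α 0)
      ((genInvGaussian lam (c * α) c).prod (invGamma lam c))
      ((genInvGaussian lam (c * α) c).prod (invGamma lam c)) := by
  have := isProbabilityMeasure_invGamma hlam hc
  obtain ⟨κ₁, h₁⟩ := normalizedDensity_eq
    (f := fun x => x ^ (-lam - 1) * Real.exp (-(c * α) * x - c * x⁻¹)) (by fun_prop)
  obtain ⟨κ₂, h₂⟩ := normalizedDensity_eq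
    (f := fun x => x ^ (-lam - 1) * Real.exp (-c * x⁻¹)) (by fun_prop)
  have hprod : (genInvGaussian lam (c * α) c).prod (invGamma lam c) =
      κ₁ • κ₂ • (haarPos.prod haarPos).withDensity fun p : PosReal × PosReal =>
        ENNReal.ofReal ((p.1 : ℝ) * ((p.1 : ℝ) ^ (-lam - 1) *
          Real.exp (-(c * α) * p.1 - c * (p.1 : ℝ)⁻¹))) *
        ENNReal.ofReal ((p.2 : ℝ) * ((p.2 : ℝ) ^ (-lam - 1) * Real.exp (-c * (p.2 : ℝ)⁻¹))) := by
    rw [genInvGaussian, invGamma, h₁, h₂, Measure.prod_smul_left, Measure.prod_smul_right,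
      prod_withDensity (by fun_prop) (by fun_prop)]
  rw [hprod]
  refine ((measurePreserving_withDensity (measurePreserving_dKdV_haarPos α) (by fun_prop)
    ?_).smul_measure κ₂).smul_measure κ₁
  rintro ⟨x, u⟩
  -- Relative to `dx/x ⊗ du/u` the density depends only on `xu` and `αx + 1/x + 1/u`, both conserved
  -- by the map.
  have key : ∀ x u : PosReal,
      ENNReal.ofReal ((x : ℝ) * ((x : ℝ) ^ (-lam - 1) *
          Real.exp (-(c * α) * x - c * (x : ℝ)⁻¹))) *
        ENNReal.ofReal ((u : ℝ) * ((u : ℝ) ^ (-lam - 1) * Real.exp (-c * (u : ℝ)⁻¹))) =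
      ENNReal.ofReal (((x * u : ℝ) * (x * u : ℝ) ^ (-lam - 1)) *
        Real.exp (-c * (α * x + (x : ℝ)⁻¹ + (u : ℝ)⁻¹))) := by
    intro x u
    have hx : (0 : ℝ) < x := x.2
    have hu : (0 : ℝ) < u := u.2
    rw [← ENNReal.ofReal_mul (by positivity), Real.mul_rpow hx.le hu.le,
      show -c * (α * x + (x : ℝ)⁻¹ + (u : ℝ)⁻¹) =
        (-(c * α) * x - c * (x : ℝ)⁻¹) + -c * (u : ℝ)⁻¹ by ring, Real.exp_add]
    congr 1
    ring
  simp only [key]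
  have hx : (0 : ℝ) < x := x.2
  have hu : (0 : ℝ) < u := u.2
  have h1 : ((dKdV α 0 (x, u)).1 * (dKdV α 0 (x, u)).2 : ℝ) = x * u := by
    rw [coe_dKdV_left_fst, coe_dKdV_left_snd]; field_simp
  have h2 : α * ((dKdV α 0 (x, u)).1 : ℝ) + ((dKdV α 0 (x, u)).1 : ℝ)⁻¹ +
      ((dKdV α 0 (x, u)).2 : ℝ)⁻¹ = α * x + (x : ℝ)⁻¹ + (u : ℝ)⁻¹ := by
    rw [coe_dKdV_left_fst, coe_dKdV_left_snd]; field_simp; ring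
  rw [h1, h2]

theorem measurePreserving_dKdV_swap {α : ℝ≥0} {lam c : ℝ} (hlam : 0 < lam) (hc : 0 < c) :
    MeasurePreserving (dKdV 0 α)
      ((invGamma lam c).prod (genInvGaussian lam (c * α) c))
      ((invGamma lam c).prod (genInvGaussian lam (c * α) c)) := by
  have := isProbabilityMeasure_invGamma hlam hc
  have := isProbabilityMeasure_genInvGaussian hlam (c₁ := c * α) (by positivity) hc
  have h := Measure.measurePreserving_swap.comp ((measurePreserving_dKdV (α := α) hlam hc).comp
    (Measure.measurePreserving_swap (μ := invGamma lam c)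
      (ν := genInvGaussian lam (c * α) c)))
  convert h using 1
  funext p
  have := dKdV_swap α 0 p.swap
  rwa [Prod.swap_swap] at this


/-! ### The dynamics of `dKdV 0 α` on its almost surely unique carriers -/

/-- A measurable version of the dynamics of `dKdV 0 α`. -/
def evolve (α : ℝ≥0) (y : ℤ → PosReal) : ℤ → PosReal :=
  fun t => (dKdV 0 α (y t, car α y (t - 1))).1

theorem dKdV_car (α : ℝ≥0) (y : ℤ → PosReal) (t : ℤ) :
    dKdV 0 α (y t, car α y (t - 1)) = (evolve α y t, car α y t) :=
  Prod.ext rfl (isCarrier_car α y t)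

theorem evolve_congr (α : ℝ≥0) {y z : ℤ → PosReal} {n : ℤ} (h : ∀ j ≤ n, y j = z j) :
    ∀ j ≤ n, evolve α y j = evolve α z j := by
  intro j hj
  simp only [evolve]
  rw [h j hj, car_congr α fun i (hi : i ≤ j - 1) => h i (by omega)]

theorem evolve_iterate_congr (α : ℝ≥0) {y z : ℤ → PosReal} {n : ℤ} (h : ∀ j ≤ n, y j = z j)
    (k : ℕ) : ∀ j ≤ n, (evolve α)^[k] y j = (evolve α)^[k] z j := by
  induction k with
  | zero => exact h
  | succ k ih =>
    simp only [Function.iterate_succ_apply']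
    exact evolve_congr α ih

theorem measurable_evolve (α : ℝ≥0) : Measurable (evolve α) :=
  measurable_pi_lambda _ fun t =>
    ((continuous_dKdV 0 α).measurable.comp
      ((measurable_pi_apply t).prodMk (measurable_car α (t - 1)))).fst

/-- Reversal of a two-sided sequence. -/
def rev {X : Type*} (y : ℤ → X) : ℤ → X := fun n => y (-n)

theorem rev_rev {X : Type*} (y : ℤ → X) : rev (rev y) = y := by
  funext n
  simp [rev]

theorem measurePreserving_rev {X : Type*} [MeasurableSpace X] (μ : Measure X)
    [IsProbabilityMeasure μ] :
    MeasurePreserving (rev (X := X)) (Measure.infinitePi fun _ => μ)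
      (Measure.infinitePi fun _ => μ) :=
  measurePreserving_reindex μ neg_injective

theorem Recurrent.evolve_eq {α : ℝ≥0} {y c v : ℤ → PosReal} (h : Recurrent α y)
    (hc : ∀ t, dKdV 0 α (y t, c (t - 1)) = (v t, c t)) : evolve α y = v := by
  have : c = car α y := h.carrier_eq fun t => by rw [hc]
  subst this
  funext t
  rw [evolve, hc]

/-- By the involution, the old carrier read backwards is a carrier of the reversed image, and
recurrence makes it the only one. -/
theorem rev_evolve_rev_evolve {α : ℝ≥0} {y : ℤ → PosReal} (h : Recurrent α (rev (evolve α y))) :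
    rev (evolve α (rev (evolve α y))) = y := by
  have : evolve α (rev (evolve α y)) = rev y := by
    refine h.evolve_eq (c := fun t => car α y (-t - 1)) fun t => ?_
    have h1 := congrArg (dKdV 0 α) (dKdV_car α y (-t))
    rw [dKdV_involutive] at h1
    dsimp only [rev]
    rw [show -(t - 1) - 1 = -t by ring, ← h1]
  rw [this, rev_rev]

/-- The inverse of `evolve`, almost everywhere. -/
def evolveInv (α : ℝ≥0) (y : ℤ → PosReal) : ℤ → PosReal := rev (evolve α (rev y))

theorem evolve_evolveInv {α : ℝ≥0} {y : ℤ → PosReal} (h : Recurrent α (evolveInv α y)) :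
    evolve α (evolveInv α y) = y := by
  have := congrArg rev (rev_evolve_rev_evolve (y := rev y) h)
  rwa [rev_rev, rev_rev] at this

theorem Recurrent.shift {α : ℝ≥0} {y : ℤ → PosReal} (h : Recurrent α y) :
    Recurrent α (shift y) := by
  obtain ⟨K, hK⟩ := h
  refine ⟨K, fun n => ?_⟩
  obtain ⟨k, hk, hy⟩ := hK (n + 1)
  refine ⟨k - 1, by omega, ?_⟩
  simpa [DiscreteKdV.shift] using hy

theorem car_shift {α : ℝ≥0} {y : ℤ → PosReal} (h : Recurrent α (shift y)) :
    car α (shift y) = shift (car α y) := by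
  refine (h.carrier_eq fun n => ?_).symm
  have := isCarrier_car α y (n + 1)
  simpa [shift] using this

theorem evolve_shift {α : ℝ≥0} {y : ℤ → PosReal} (h : Recurrent α (shift y)) :
    evolve α (shift y) = shift (evolve α y) := by
  funext t
  rw [evolve, car_shift h]
  simp [shift, evolve]

theorem evolveInv_shift {α : ℝ≥0} {y : ℤ → PosReal} (h : Recurrent α (rev y)) :
    evolveInv α (shift y) = shift (evolveInv α y) := by
  have h1 : shift (rev (shift y)) = rev y := by
    funext n
    simp [shift, rev]
  have h2 := evolve_shift (α := α) (y := rev (shift y)) (h1 ▸ h)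
  rw [evolveInv, evolveInv, ← h1, h2]
  funext n
  simp [shift, rev]

/-! ### Burke's property -/

/-- Law of an initial carrier (at `none`) and of a configuration. -/
def startLaw (μ ν : Measure PosReal) : Option ℤ → Measure PosReal
  | none => μ
  | some _ => ν

instance (μ ν : Measure PosReal) [IsProbabilityMeasure μ] [IsProbabilityMeasure ν] (o : Option ℤ) :
    IsProbabilityMeasure (startLaw μ ν o) := by
  cases o <;> assumption

/-- The configuration part. -/
def config (z : Option ℤ → PosReal) : ℤ → PosReal := fun t => z (some t)

theorem measurable_config : Measurable config :=
  measurable_pi_lambda _ fun t => measurable_pi_apply (some t)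

/-- One step of the dynamics, at site `s`. -/
def step (α : ℝ≥0) (s : ℤ) (z : Option ℤ → PosReal) : Option ℤ → PosReal :=
  Function.update (Function.update z (some s) (dKdV 0 α (z (some s), z none)).1) none
    (dKdV 0 α (z (some s), z none)).2

/-- The dynamics at the `j` sites starting from `s`. -/
def run (α : ℝ≥0) (s : ℤ) : ℕ → (Option ℤ → PosReal) → Option ℤ → PosReal
  | 0, z => z
  | j + 1, z => step α (s + j) (run α s j z)

/-- The carrier after `j` steps, started with `ξ` at site `s - 1`. -/
def chain (α : ℝ≥0) (y : ℤ → PosReal) (ξ : PosReal) (s : ℤ) : ℕ → PosReal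
  | 0 => ξ
  | j + 1 => next α (y (s + j)) (chain α y ξ s j)

theorem run_apply (α : ℝ≥0) (s : ℤ) (j : ℕ) (z : Option ℤ → PosReal) :
    run α s j z none = chain α (config z) (z none) s j ∧
    ∀ t, run α s j z (some t) = if s ≤ t ∧ t < s + j then
      (dKdV 0 α (z (some t), chain α (config z) (z none) s (t - s).toNat)).1 else z (some t) := by
  induction j with
  | zero =>
    refine ⟨rfl, fun t => ?_⟩
    rw [if_neg (by push_cast; omega), run]
  | succ j ih =>
    have hs : run α s j z (some (s + j)) = z (some (s + j)) := by
      rw [ih.2, if_neg (by omega)]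
    refine ⟨?_, fun t => ?_⟩
    · simp only [run, step, Function.update_self, chain]
      rw [ih.1, hs]
      rfl
    · simp only [run, step]
      rw [Function.update_of_ne (by simp), Function.update_apply]
      simp only [Option.some.injEq]
      split_ifs with h1 h2 h2
      · subst h1
        rw [hs, ih.1]
        simp
      · push_cast at h2
        omega
      · rw [ih.2, if_pos (by push_cast at h2; omega)]
      · rw [ih.2, if_neg (by push_cast at h2; omega)]

theorem isCarrierAfter_chain (α : ℝ≥0) (y : ℤ → PosReal) (ξ : PosReal) (s : ℤ) :
    IsCarrierAfter α y (fun n => chain α y ξ s (n - s + 1).toNat) (s - 1) := by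
  intro n hn
  obtain ⟨j, rfl⟩ : ∃ j : ℕ, n = s + j := ⟨(n - s).toNat, by omega⟩
  dsimp only
  rw [show (s + j - 1 - s + 1 : ℤ).toNat = j by omega,
    show (s + j - s + 1 : ℤ).toNat = j + 1 by omega, chain]

/-- Stationary limit of `run`: the carrier at site `k` and the configuration updated up to `k`. -/
def updateTo (α : ℝ≥0) (k : ℤ) (y : ℤ → PosReal) : Option ℤ → PosReal
  | none => car α y k
  | some t => if t ≤ k then evolve α y t else y t

theorem measurable_updateTo (α : ℝ≥0) (k : ℤ) : Measurable (updateTo α k) := by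
  refine measurable_pi_lambda _ fun o => ?_
  cases o with
  | none => exact measurable_car α k
  | some t =>
    simp only [updateTo]
    split_ifs
    · exact (measurable_pi_apply t).comp (measurable_evolve α)
    · exact measurable_pi_apply t

/-- Running from `-m + 1` to `k` with an arbitrary initial carrier `z none`, contraction forgets
that carrier as `m → ∞`. -/
theorem Recurrent.tendsto_run {α : ℝ≥0} {z : Option ℤ → PosReal} (h : Recurrent α (config z))
    (k : ℤ) : Tendsto (fun m : ℕ => run α (-m + 1) (k + m).toNat z) atTop
      (𝓝 (updateTo α k (config z))) := by
  have hlim := h.tendsto_of_isCarrierAfter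
    (a := fun m n => chain α (config z) (z none) (-m + 1) (n - (-m + 1) + 1).toNat)
    (fun m => by simpa using isCarrierAfter_chain α (config z) (z none) (-m + 1))
    (isCarrier_car α (config z))
  refine tendsto_pi_nhds.2 fun o => ?_
  cases o with
  | none =>
    refine (hlim k).congr fun m => ?_
    rw [(run_apply _ _ _ _).1]
    congr 2
    ring
  | some t =>
    simp only [updateTo, (run_apply _ _ _ _).2]
    split_ifs with ht
    · have h1 : Tendsto (fun m : ℕ => (dKdV 0 α (z (some t), chain α (config z) (z none) (-m + 1)
          (t - 1 - (-m + 1) + 1).toNat)).1) atTop (𝓝 (evolve α (config z) t)) :=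
        Tendsto.comp (f := fun m : ℕ => (z (some t), chain α (config z) (z none) (-m + 1)
          (t - 1 - (-m + 1) + 1).toNat))
          ((continuous_fst.comp (continuous_dKdV 0 α)).tendsto (z (some t), _))
          (tendsto_const_nhds.prodMk_nhds (hlim (t - 1)))
      refine h1.congr' ?_
      filter_upwards [eventually_ge_atTop (1 - t).toNat] with m hm
      rw [if_pos (by omega), show t - 1 - (-m + 1) + 1 = t - (-m + 1) by ring]
    · refine tendsto_const_nhds.congr fun m => ?_
      rw [if_neg (by omega)]
      rfl

/-! ### Laws under product measures -/

section Law

variable {α : ℝ≥0} {μ ν : Measure PosReal} [IsProbabilityMeasure μ] [IsProbabilityMeasure ν]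

/-- Poincaré recurrence for the right shift and the events `α y_0 y_{-1} ≤ K`, with `K` chosen
according to `y`; no moment of `ν` enters. -/
theorem ae_recurrent (α : ℝ≥0) (ν : Measure PosReal) [IsProbabilityMeasure ν] :
    ∀ᵐ y ∂Measure.infinitePi fun _ : ℤ => ν, Recurrent α y := by
  have hmp := measurePreserving_reindex ν (sub_left_injective (b := (1 : ℤ)))
  have hs : ∀ K : ℕ, MeasurableSet
      {y : ℤ → PosReal | (α : ℝ) * y 0 * y (-1) ≤ K} := fun K =>
    measurableSet_le (by fun_prop) measurable_const
  have h := ae_all_iff.2 fun K : ℕ =>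
    hmp.conservative.ae_mem_imp_frequently_image_mem (hs K).nullMeasurableSet
  have hit : ∀ (m : ℕ) (y : ℤ → PosReal) (k : ℤ),
      (fun (y : ℤ → PosReal) k => y (k - 1))^[m] y k = y (k - m) := by
    intro m
    induction m with
    | zero => simp
    | succ m ih =>
      intro y k
      rw [Function.iterate_succ_apply, ih]
      push_cast
      rw [sub_sub]
  filter_upwards [h] with y hy
  obtain ⟨K, hK⟩ := exists_nat_ge ((α : ℝ) * y 0 * y (-1))
  refine ⟨K, fun n => ?_⟩
  obtain ⟨m, hm, hmK⟩ := frequently_atTop.1 (hy K hK) (-n).toNat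
  refine ⟨-m, by omega, ?_⟩
  rw [hit, hit, zero_sub, show (-1 : ℤ) - m = -m - 1 by ring] at hmK
  exact hmK

theorem measurePreserving_config : MeasurePreserving config
    (Measure.infinitePi (startLaw μ ν)) (Measure.infinitePi fun _ : ℤ => ν) :=
  ⟨measurable_config, Measure.map_infinitePi_infinitePi_of_inj (P := startLaw μ ν) (Option.some_injective ℤ)⟩

theorem measurePreserving_run (h : MeasurePreserving (dKdV 0 α) (ν.prod μ) (ν.prod μ)) (s : ℤ)
    (j : ℕ) : MeasurePreserving (run α s j)
      (Measure.infinitePi (startLaw μ ν)) (Measure.infinitePi (startLaw μ ν)) := by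
  induction j with
  | zero => exact MeasurePreserving.id _
  | succ j ih =>
    exact (measurePreserving_update_update (startLaw μ ν) (i := some (s + j)) (j := none)
      (by simp) h).comp ih

theorem ae_recurrent_config : ∀ᵐ z ∂Measure.infinitePi (startLaw μ ν), Recurrent α (config z) :=
  measurePreserving_config.quasiMeasurePreserving.ae (ae_recurrent α ν)

theorem measurePreserving_of_comp_config {E : Type*} [MeasurableSpace E] {Q : Measure E}
    {f : (ℤ → PosReal) → E} (hf : Measurable f)
    (h : MeasurePreserving (fun z => f (config z)) (Measure.infinitePi (startLaw μ ν)) Q) :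
    MeasurePreserving f (Measure.infinitePi fun _ : ℤ => ν) Q := by
  refine ⟨hf, ?_⟩
  rw [← (measurePreserving_config (μ := μ) (ν := ν)).map_eq,
    Measure.map_map hf measurable_config]
  exact h.map_eq

/-- Burke's property: the carrier at `k`, the updated configuration up to `k` and the old
configuration after `k` are independent. -/
theorem measurePreserving_updateTo (h : MeasurePreserving (dKdV 0 α) (ν.prod μ) (ν.prod μ))
    (k : ℤ) : MeasurePreserving (updateTo α k) (Measure.infinitePi fun _ : ℤ => ν)
      (Measure.infinitePi (startLaw μ ν)) :=
  measurePreserving_of_comp_config (μ := μ) (measurable_updateTo α k)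
    (map_eq_of_tendsto (fun _ => measurePreserving_run h _ _)
      ((measurable_updateTo α k).comp measurable_config)
      (ae_recurrent_config.mono fun _ hz => hz.tendsto_run k))

/-- The configuration updated up to `k` has law `ν^ℤ`, and each of its coordinates is eventually
that of `evolve`. -/
theorem measurePreserving_evolve (h : MeasurePreserving (dKdV 0 α) (ν.prod μ) (ν.prod μ)) :
    MeasurePreserving (evolve α) (Measure.infinitePi fun _ : ℤ => ν)
      (Measure.infinitePi fun _ : ℤ => ν) := by
  refine map_eq_of_tendsto
    (fun k : ℕ => (measurePreserving_config (μ := μ)).comp (measurePreserving_updateTo h k))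
    (measurable_evolve α) (ae_of_all _ fun y => tendsto_pi_nhds.2 fun t => ?_)
  refine tendsto_const_nhds.congr' ?_
  filter_upwards [eventually_ge_atTop t.toNat] with k hk
  simp only [Function.comp, config, updateTo]
  rw [if_pos (by omega)]

theorem infinitePi_startLaw_none_config {A : Set PosReal} (hA : MeasurableSet A)
    {C : Set (ℤ → PosReal)} (hC : MeasurableSet C) :
    Measure.infinitePi (startLaw μ ν) {z | z none ∈ A ∧ config z ∈ C} =
      μ A * (Measure.infinitePi fun _ : ℤ => ν) C := by
  classical
  let e : PosReal × (ℤ → PosReal) → Option ℤ → PosReal := fun p o => o.elim p.1 p.2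
  have he : Measurable e := by
    refine measurable_pi_lambda _ fun o => ?_
    cases o with
    | none => exact measurable_fst
    | some t => exact (measurable_pi_apply t).comp measurable_snd
  have hlaw : (μ.prod (Measure.infinitePi fun _ : ℤ => ν)).map e =
      Measure.infinitePi (startLaw μ ν) := by
    refine Measure.eq_infinitePi _ fun s t ht => ?_
    rw [Measure.map_apply he (MeasurableSet.pi s.countable_toSet fun o _ => ht o)]
    have hpre : e ⁻¹' Set.pi s t = (if none ∈ s then t none else Set.univ) ×ˢ
        Set.pi s.eraseNone fun i => t (some i) := by
      ext p
      simp only [Set.mem_preimage, Set.mem_pi, Set.mem_prod, Finset.mem_coe,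
        Finset.mem_eraseNone, Option.forall, e, Option.elim]
      split_ifs with hn <;> simp [hn]
    rw [hpre, Measure.prod_prod, Measure.infinitePi_pi _ fun i _ => ht (some i)]
    have hsome : ∏ i ∈ s.eraseNone, ν (t (some i)) = ∏ o ∈ s.erase none, startLaw μ ν o (t o) := by
      rw [← Finset.map_some_eraseNone, Finset.prod_map]
      rfl
    rw [hsome]
    split_ifs with hn
    · rw [← Finset.mul_prod_erase s _ hn]
      rfl
    · rw [measure_univ, one_mul, Finset.erase_eq_of_notMem hn]
  have hset : MeasurableSet {z : Option ℤ → PosReal | z none ∈ A ∧ config z ∈ C} :=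
    (measurable_pi_apply none hA).inter
      (measurable_config hC)
  rw [← hlaw, Measure.map_apply he hset, ← Measure.prod_prod]
  rfl

/-- The carriers at time `-1` of the successive images of a configuration. -/
def carrierRow (α : ℝ≥0) (y : ℤ → PosReal) (j : ℕ) : PosReal := car α ((evolve α)^[j] y) (-1)

theorem measurable_carrierRow (α : ℝ≥0) : Measurable (carrierRow α) :=
  measurable_pi_lambda _ fun j => (measurable_car α (-1)).comp ((measurable_evolve α).iterate j)

/-- Causality: the carriers at `-1` see only sites up to `-1`, where `evolve` and the partial update
agree. -/
theorem carrierRow_succ (α : ℝ≥0) (y : ℤ → PosReal) (j : ℕ) :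
    carrierRow α y (j + 1) = carrierRow α (config (updateTo α (-1) y)) j := by
  refine car_congr α (evolve_iterate_congr α (y := evolve α y) (fun i hi => ?_) j)
  simp only [config, updateTo]
  rw [if_pos hi]

/-- By Burke's property at site `-1`, the first carrier is independent of a configuration of law
`ν^ℤ` whose own row is the tail. Peeling off one carrier at a time gives the product law. -/
theorem measurePreserving_carrierRow
    (h : MeasurePreserving (dKdV 0 α) (ν.prod μ) (ν.prod μ)) :
    MeasurePreserving (carrierRow α) (Measure.infinitePi fun _ : ℤ => ν)
      (Measure.infinitePi fun _ : ℕ => μ) := by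
  classical
  have hbox : ∀ (N : ℕ) (t : ℕ → Set PosReal), (∀ j, MeasurableSet (t j)) →
      (Measure.infinitePi fun _ : ℤ => ν) {y | ∀ j < N, carrierRow α y j ∈ t j} =
        ∏ j ∈ Finset.range N, μ (t j) := by
    intro N
    induction N with
    | zero => simp
    | succ N ih =>
      intro t ht
      set C : Set (ℤ → PosReal) := {y | ∀ j < N, carrierRow α y j ∈ t (j + 1)} with hCdef
      have hC : MeasurableSet C := by
        have : C = ⋂ j, ⋂ _ : j < N, (fun y => carrierRow α y j) ⁻¹' t (j + 1) := by
          ext y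
          simp [hCdef]
        rw [this]
        exact .iInter fun j => .iInter fun _ =>
          ((measurable_pi_apply j).comp (measurable_carrierRow α)) (ht _)
      have hset : {y | ∀ j < N + 1, carrierRow α y j ∈ t j} =
          updateTo α (-1) ⁻¹' {z | z none ∈ t 0 ∧ config z ∈ C} := by
        ext y
        simp only [Set.mem_ofPred_eq, Set.mem_preimage, hCdef, ← carrierRow_succ]
        constructor
        · exact fun hy => ⟨hy 0 (by omega), fun j hj => hy (j + 1) (by omega)⟩
        · rintro ⟨h0, h1⟩ (_ | j) hj
          · exact h0
          · exact h1 j (by omega)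
      have hm : MeasurableSet {z : Option ℤ → PosReal | z none ∈ t 0 ∧ config z ∈ C} :=
        (measurable_pi_apply none (ht 0)).inter
          (measurable_config hC)
      rw [hset, (measurePreserving_updateTo h (-1)).measure_preimage hm.nullMeasurableSet,
        infinitePi_startLaw_none_config (ht 0) hC, ih _ fun j => ht (j + 1),
        Finset.prod_range_succ', mul_comm]
  refine ⟨measurable_carrierRow α, Measure.eq_infinitePi _ fun s t ht => ?_⟩
  rw [Measure.map_apply (measurable_carrierRow α)
    (MeasurableSet.pi s.countable_toSet fun j _ => ht j)]
  obtain ⟨N, hN⟩ := s.exists_nat_subset_range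
  have hset : carrierRow α ⁻¹' Set.pi s t =
      {y | ∀ j < N, carrierRow α y j ∈ if j ∈ s then t j else Set.univ} := by
    ext y
    simp only [Set.mem_preimage, Set.mem_pi, Finset.mem_coe, Set.mem_ofPred_eq]
    constructor
    · intro hy j _
      split_ifs with hj
      · exact hy j hj
      · trivial
    · intro hy j hj
      have := hy j (Finset.mem_range.1 (hN hj))
      rwa [if_pos hj] at this
  rw [hset, hbox N _ fun j => by split_ifs; exacts [ht j, .univ]]
  refine (Finset.prod_subset hN fun j _ hj => by simp [hj]).symm.trans ?_
  exact Finset.prod_congr rfl fun j hj => by rw [if_pos hj]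

end Law


/-! ### The space-time field -/

/-- The two-sided orbit of a configuration under `evolve`. -/
def orbit (α : ℝ≥0) (y : ℤ → PosReal) : ℤ → ℤ → PosReal
  | Int.ofNat n => (evolve α)^[n] y
  | Int.negSucc n => (evolveInv α)^[n + 1] y

/-- Configurations whose orbit is recurrent in both directions. -/
def recurrentOrbits (α : ℝ≥0) : Set (ℤ → PosReal) :=
  {y | ∀ n, Recurrent α (orbit α y n) ∧ Recurrent α (rev (orbit α y n))}

theorem orbit_negSucc (α : ℝ≥0) (y : ℤ → PosReal) (n : ℕ) :
    orbit α y (Int.negSucc n) = evolveInv α (orbit α y (Int.negSucc n + 1)) := by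
  cases n with
  | zero => rfl
  | succ n =>
    rw [show Int.negSucc (n + 1) + 1 = Int.negSucc n by omega]
    exact Function.iterate_succ_apply' _ _ _

theorem evolve_orbit {α : ℝ≥0} {y : ℤ → PosReal} (hy : y ∈ recurrentOrbits α) (n : ℤ) :
    evolve α (orbit α y n) = orbit α y (n + 1) := by
  cases n with
  | ofNat n => exact (Function.iterate_succ_apply' _ _ _).symm
  | negSucc n =>
    have h := (hy (Int.negSucc n)).1
    rw [orbit_negSucc] at h ⊢
    exact evolve_evolveInv h

theorem iterate_evolve_orbit {α : ℝ≥0} {y : ℤ → PosReal} (hy : y ∈ recurrentOrbits α) (n : ℤ)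
    (j : ℕ) : (evolve α)^[j] (orbit α y n) = orbit α y (n + j) := by
  induction j with
  | zero => simp
  | succ j ih =>
    rw [Function.iterate_succ_apply', ih, evolve_orbit hy]
    push_cast
    rw [add_assoc]

theorem orbit_evolve {α : ℝ≥0} {y : ℤ → PosReal} (hy : y ∈ recurrentOrbits α) (n : ℤ) :
    orbit α (evolve α y) n = orbit α y (n + 1) := by
  cases n with
  | ofNat n => rfl
  | negSucc n =>
    have h : evolveInv α (evolve α y) = y := rev_evolve_rev_evolve (hy 1).2
    have h1 : orbit α (evolve α y) (Int.negSucc n) = (evolveInv α)^[n] y := by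
      change (evolveInv α)^[n] (evolveInv α (evolve α y)) = _
      rw [h]
    rw [h1]
    cases n with
    | zero => rfl
    | succ n => rw [show Int.negSucc (n + 1) + 1 = Int.negSucc n by omega]; rfl

theorem evolve_mem_recurrentOrbits {α : ℝ≥0} {y : ℤ → PosReal} (hy : y ∈ recurrentOrbits α) :
    evolve α y ∈ recurrentOrbits α := fun n => by
  rw [orbit_evolve hy]
  exact hy (n + 1)

theorem orbit_shift {α : ℝ≥0} {y : ℤ → PosReal} (hy : y ∈ recurrentOrbits α) (n : ℤ) :
    orbit α (shift y) n = shift (orbit α y n) := by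
  cases n with
  | ofNat n =>
    induction n with
    | zero => rfl
    | succ n ih =>
      have h : ∀ y, orbit α y (Int.ofNat (n + 1)) = evolve α (orbit α y (Int.ofNat n)) :=
        fun y => Function.iterate_succ_apply' _ _ _
      rw [h, h, ih, evolve_shift (hy _).1.shift]
  | negSucc n =>
    induction n with
    | zero => exact evolveInv_shift (hy 0).2
    | succ n ih =>
      have h : Int.negSucc (n + 1) + 1 = Int.negSucc n := by omega
      rw [orbit_negSucc, orbit_negSucc α y, h, ih, evolveInv_shift (hy _).2]

/-- The solution `(x_n^t, u_n^t)` with `u_0 = y`. -/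
def field (α : ℝ≥0) (y : ℤ → PosReal) : (ℤ → ℤ → PosReal) × (ℤ → ℤ → PosReal) :=
  (fun t n => car α (orbit α y (n - 1)) (t - 1), fun t n => orbit α y n t)

/-- The initial values `(x_n^0)` of the solution with `u_0 = y`. -/
def initialRow (α : ℝ≥0) (y : ℤ → PosReal) : ℤ → PosReal := (field α y).1 0

theorem isSolution_field {α : ℝ≥0} {y : ℤ → PosReal} (hy : y ∈ recurrentOrbits α) :
    IsSolution (dKdV α 0) (initialRow α y) (field α y) := by
  refine ⟨fun n t => ?_, fun _ => rfl⟩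
  -- One application of `evolve` is a step in space; one step along the carrier is a step in time.
  have h := dKdV_swap 0 α (orbit α y (n - 1) t, car α (orbit α y (n - 1)) (t - 1))
  rw [dKdV_car, evolve_orbit hy, sub_add_cancel] at h
  simpa [field] using h

theorem initialRow_shift {α : ℝ≥0} {y : ℤ → PosReal} (hy : y ∈ recurrentOrbits α) :
    initialRow α (shift y) = (field α y).1 1 := by
  funext n
  simp only [initialRow, field]
  rw [orbit_shift hy, car_shift (hy _).1.shift]
  rfl

/-- Evolving the column translates the field in space, just as shifting it translates the field in
time. -/
theorem initialRow_evolve {α : ℝ≥0} {y : ℤ → PosReal} (hy : y ∈ recurrentOrbits α) :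
    initialRow α (evolve α y) = shift (initialRow α y) := by
  funext n
  simp only [initialRow, field, shift]
  rw [orbit_evolve hy, sub_add_cancel, add_sub_cancel_right]

theorem mem_dynamics_initialRow {α : ℝ≥0} (hα : 0 < α) {y : ℤ → PosReal}
    (hy : y ∈ recurrentOrbits α) :
    initialRow α (shift y) ∈ dynamics (dKdV α 0) (initialRow α y) := by
  rw [initialRow_shift hy]
  have h := isSolution_field hy
  exact mem_dynamics_of_isSolution ⟨field α y, h, fun q hq => hq.eq hα h⟩ h

/-- The row determines the whole solution, and `y` is its column at site `0`. -/
theorem injOn_initialRow {α : ℝ≥0} (hα : 0 < α) :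
    Set.InjOn (initialRow α) (recurrentOrbits α) := by
  intro y hy y' hy' h
  have h1 := (isSolution_field hy).eq hα (h ▸ isSolution_field hy')
  exact funext fun t => congrFun (congrFun (congrArg Prod.snd h1) t) 0

theorem measurable_orbit (α : ℝ≥0) (n : ℤ) : Measurable fun y => orbit α y n := by
  have hrev : Measurable (rev : (ℤ → PosReal) → _) :=
    measurable_pi_lambda _ fun t => measurable_pi_apply (-t)
  cases n with
  | ofNat n => exact (measurable_evolve α).iterate n
  | negSucc n => exact (hrev.comp ((measurable_evolve α).comp hrev)).iterate (n + 1)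

theorem measurable_initialRow (α : ℝ≥0) : Measurable (initialRow α) :=
  measurable_pi_lambda _ fun n => (measurable_car α (0 - 1)).comp (measurable_orbit α (n - 1))

/-! ### Law of the initial row and ergodicity -/

section Law

variable {α : ℝ≥0} {μ ν : Measure PosReal} [IsProbabilityMeasure μ] [IsProbabilityMeasure ν]

theorem measurePreserving_orbit (h : MeasurePreserving (dKdV 0 α) (ν.prod μ) (ν.prod μ)) (n : ℤ) :
    MeasurePreserving (fun y => orbit α y n) (Measure.infinitePi fun _ : ℤ => ν)
      (Measure.infinitePi fun _ : ℤ => ν) := by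
  cases n with
  | ofNat n => exact (measurePreserving_evolve h).iterate n
  | negSucc n =>
    exact ((measurePreserving_rev ν).comp
      ((measurePreserving_evolve h).comp (measurePreserving_rev ν))).iterate (n + 1)

theorem ae_mem_recurrentOrbits (h : MeasurePreserving (dKdV 0 α) (ν.prod μ) (ν.prod μ)) :
    ∀ᵐ y ∂Measure.infinitePi fun _ : ℤ => ν, y ∈ recurrentOrbits α := by
  refine ae_all_iff.2 fun n => ?_
  have h1 := measurePreserving_orbit h n
  exact (h1.quasiMeasurePreserving.ae (ae_recurrent α ν)).and
    (((measurePreserving_rev ν).comp h1).quasiMeasurePreserving.ae (ae_recurrent α ν))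

/-- To the right of `-N`, the row consists of the carriers of the forward orbit started at the
column `-N - 1`, which has law `ν^ℤ`. -/
theorem measurePreserving_initialRow_window
    (h : MeasurePreserving (dKdV 0 α) (ν.prod μ) (ν.prod μ)) (N : ℕ) :
    MeasurePreserving (fun y (j : ℕ) => initialRow α y (j - N))
      (Measure.infinitePi fun _ : ℤ => ν) (Measure.infinitePi fun _ : ℕ => μ) := by
  have h1 := (measurePreserving_carrierRow h).comp (measurePreserving_orbit h (-N - 1))
  refine ⟨measurable_pi_lambda _ fun j =>
    (measurable_pi_apply _).comp (measurable_initialRow α), ?_⟩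
  rw [← h1.map_eq]
  refine Measure.map_congr ?_
  filter_upwards [ae_mem_recurrentOrbits h] with y hy
  funext j
  simp only [initialRow, field, Function.comp, carrierRow, iterate_evolve_orbit hy]
  rw [show (j : ℤ) - N - 1 = -N - 1 + j by ring, zero_sub]

theorem measurePreserving_initialRow
    (h : MeasurePreserving (dKdV 0 α) (ν.prod μ) (ν.prod μ)) :
    MeasurePreserving (initialRow α) (Measure.infinitePi fun _ : ℤ => ν)
      (Measure.infinitePi fun _ : ℤ => μ) := by
  classical
  refine ⟨measurable_initialRow α, Measure.eq_infinitePi _ fun s t ht => ?_⟩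
  rw [Measure.map_apply (measurable_initialRow α)
    (MeasurableSet.pi s.countable_toSet fun j _ => ht j)]
  set N : ℕ := s.sup Int.natAbs
  have hN : ∀ i ∈ s, ((i + N).toNat : ℤ) - N = i := fun i hi => by
    have : i.natAbs ≤ N := Finset.le_sup (f := Int.natAbs) hi
    omega
  have hinj : Set.InjOn (fun i : ℤ => (i + N : ℤ).toNat) s := fun i hi j hj hij => by
    have h2 : (i + N).toNat = (j + N).toNat := hij
    rw [← hN i hi, ← hN j hj, h2]
  have hset : initialRow α ⁻¹' Set.pi s t = (fun y (j : ℕ) => initialRow α y (j - N)) ⁻¹'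
      Set.pi (s.image fun i : ℤ => (i + N).toNat) fun j => t (j - N) := by
    ext y
    simp only [Set.mem_preimage, Set.mem_pi, Finset.mem_coe, Finset.forall_mem_image]
    exact forall₂_congr fun i hi => by rw [hN i hi]
  rw [hset, (measurePreserving_initialRow_window h N).measure_preimage
    (MeasurableSet.pi (Finset.countable_toSet _) fun j _ => ht _).nullMeasurableSet,
    Measure.infinitePi_pi _ fun j _ => ht _, Finset.prod_image hinj]
  exact Finset.prod_congr rfl fun i hi => by rw [hN i hi]

/-- If `dKdV 0 α` preserves `ν ⊗ μ`, then `μ^ℤ` is ergodic for `dKdV α 0` and `ν^ℤ` is ergodic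
for `dKdV 0 α`: both systems are factors of Bernoulli shifts. -/
theorem isErgodicUnder_dynamics (hα : 0 < α)
    (h : MeasurePreserving (dKdV 0 α) (ν.prod μ) (ν.prod μ)) :
    IsErgodicUnder (dynamics (dKdV α 0)) (Measure.infinitePi fun _ : ℤ => μ) ∧
      IsErgodicUnder (dynamics (dKdV 0 α)) (Measure.infinitePi fun _ : ℤ => ν) := by
  have : StandardBorelSpace PosReal := (measurableSet_Ioi (a := (0 : ℝ))).standardBorel
  have : Nonempty PosReal := ⟨⟨1, Set.mem_Ioi.2 one_pos⟩⟩
  have hΦ := measurePreserving_initialRow h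
  have hmem := ae_mem_recurrentOrbits h
  obtain ⟨ψ, hψ, hψΦ, hΦψ⟩ :=
    exists_measurable_leftInverse hΦ.measurable hmem (injOn_initialRow hα)
  rw [hΦ.map_eq] at hΦψ
  have hψmp : MeasurePreserving ψ (Measure.infinitePi fun _ : ℤ => μ)
      (Measure.infinitePi fun _ : ℤ => ν) := by
    refine ⟨hψ, ?_⟩
    rw [← hΦ.map_eq, Measure.map_map hψ hΦ.measurable,
      show Measure.map (ψ ∘ initialRow α) (Measure.infinitePi fun _ : ℤ => ν) = _ from
        Measure.map_congr hψΦ, Measure.map_id']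
  -- The first dynamics is the column shift conjugated by `Φ`; the second is a factor of the row
  -- shift through `ψ`, the inverse of `Φ`.
  refine ⟨⟨inferInstance, initialRow α ∘ shift ∘ ψ, ?_, ?_⟩, ⟨inferInstance, evolve α, ?_, ?_⟩⟩
  · refine ergodic_of_ae_semiconj hΦ (ergodic_shift ν)
      (hΦ.measurable.comp ((measurePreserving_shift ν).measurable.comp hψ)) ?_
    filter_upwards [hψΦ] with y hy
    simp only [Function.comp]
    rw [hy]
  · filter_upwards [hΦψ]
    rintro _ ⟨y, hy, rfl, hy'⟩
    simp only [Function.comp]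
    rw [hy']
    exact mem_dynamics_initialRow hα hy
  · refine ergodic_of_ae_semiconj hψmp (ergodic_shift μ) (measurable_evolve α) ?_
    filter_upwards [hΦψ, (measurePreserving_shift μ).quasiMeasurePreserving.ae hΦψ]
    rintro _ ⟨y, hy, rfl, hy'⟩ ⟨z, hz, hzy, hz'⟩
    rw [hy', hz']
    refine injOn_initialRow hα (evolve_mem_recurrentOrbits hy) hz ?_
    rw [initialRow_evolve hy, hzy]
  · filter_upwards [ae_recurrent α ν] with y hy
    exact mem_dynamics_of_isCarrier hy.mem_uniqueCarrierSet (isCarrier_car α y)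

end Law

end DiscreteKdV

end

/-- The logarithmic moment condition is not needed in this argument. For `dKdV α 0`, solutions of the
initial value problem are unique as soon as they exist, and almost sure existence is obtained from
the field generated by a column with law `ν^ℤ`. (By detailed balance, the analogous condition for
`genInvGaussian` in place of `invGamma` even holds automatically.) -/
theorem theorem3p13 (α : ℝ≥0) (hα : 0 < α) (lam c : ℝ) (hlam : 0 < lam) (hc : 0 < c)
    (hlog : 2 * ∫ x : DiscreteKdV.PosReal, Real.log (x : ℝ) ∂(DiscreteKdV.invGamma lam c)
      < -Real.log (α : ℝ)) :
    DiscreteKdV.IsErgodicUnder (DiscreteKdV.dynamics (DiscreteKdV.dKdV α 0))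
      (Measure.infinitePi fun _ : ℤ => DiscreteKdV.genInvGaussian lam (c * α) c) ∧
    DiscreteKdV.IsErgodicUnder (DiscreteKdV.dynamics (DiscreteKdV.dKdV 0 α))
      (Measure.infinitePi fun _ : ℤ => DiscreteKdV.invGamma lam c) := by
  have := DiscreteKdV.isProbabilityMeasure_invGamma hlam hc
  have := DiscreteKdV.isProbabilityMeasure_genInvGaussian hlam (c₁ := c * α) (by positivity) hc
  exact DiscreteKdV.isErgodicUnder_dynamics hα (DiscreteKdV.measurePreserving_dKdV_swap hlam hc)
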